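/- A principal screens an agent whose type $t$ lies in $\mathcal T=[t_0,t_1]$ with $t_0<t_1$ and has a continuous, strictly positive density $f$ on $\mathcal T$. The set $\mathcal X$ of allocations consists of all measurable functions $x:[0,1]\to[0,1]$, endowed with the $L_1$ distance (with respect to Lebesgue measure) and its Borel $\sigma$-algebra, and it is augmented with an outside option $\varnothing$. Type $t$ values $x\in\mathcal X$ at $$v(x,t)=\int_{[0,1]} x(s)\,u(s,t)\,dG(s),$$ and $v(\varnothing,t)=0$. Here $G$ is a finite measure on $[0,1]$ (for example, a probability distribution) that is absolutely continuous with respect to Lebesgue measure and has full support, and $u:[0,1]\times\mathcal T\to(0,\infty)$ is a bounded measurable function that, for every $s$, is continuously differentiable in $t$, with $u_t$ bounded uniformly in $(s,t)$. A mechanism is a measurable map $(x,p):\mathcal T\to(\mathcal X\cup\{\varnothing\})\times\mathbb R$ such that, for all $t,\hat t\in\mathcal T$, $$v(x(t),t)-p(t)\ \ge\ v(x(\hat t),t)-p(\hat t)\qquad\text{and}\qquad v(x(t),t)-p(t)\ \ge\ 0 .$$ The principal's objective is $$\mathbb E\big[\lambda(t)\big(v(x(t),t)-p(t)\big)\big]+\mathbb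 E[p(t)],$$ where $\lambda:\mathcal T\to[0,\infty)$ is continuous and non-increasing with $\mathbb E[\lambda(t)]\le 1$; expectations are with respect to the density $f$. A set $\mathcal Y\subseteq\mathcal X$ is an optimal menu if there is a mechanism $(x,p)$ that maximizes the objective among all mechanisms and satisfies $x(t)\in\mathcal Y\cup\{\varnothing\}$ for all $t\in\mathcal T$. **Proposition.** Suppose that $u(s,t)$ is strictly increasing in $t$ for every $s\in[0,1]$. 1. If $u$ is log-supermodular, that is, $\log u(s,t')+\log u(s',t)\le \log u(s,t)+\log u(s',t')$ for all $s\le s'$ in $[0,1]$ and $t\le t'$ in $\mathcal T$, then $\{\mathbf 1_{[0,k]}\}_{k\in[0,1]}$ is an optimal menu. 2. If $u$ is log-submodular, that is, the reverse inequality holds for all such $s,s',t,t'$, then $\{\mathbf 1_{[k,1]}\}_{k\in[0,1]}$ is an optimal menu. -/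

import Mathlib

open MeasureTheory

noncomputable section

/-! ### Screening problems -/

namespace Screening

/-- An allocation space `X` augmented with the outside option `Sum.inr ()`. -/
abbrev WithOutside (X : Type*) := X ⊕ Unit

/-- Values on the augmented allocation space: the outside option is worth `0` to every type. -/
def extend {X T : Type*} (v : X → T → ℝ) : WithOutside X → T → ℝ
  | Sum.inl x, t => v x t
  | Sum.inr _, _ => 0

/-- A direct-revelation mechanism: a measurable map `t ↦ (x t, p t)` that satisfies incentive
compatibility and individual rationality for every type. -/
structure IsMechanism {X T : Type*} [MeasurableSpace X] [MeasurableSpace T]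
    (v : X → T → ℝ) (x : T → WithOutside X) (p : T → ℝ) : Prop where
  measurable : Measurable fun t => (x t, p t)
  ic : ∀ t t' : T, extend v (x t') t - p t' ≤ extend v (x t) t - p t
  ir : ∀ t : T, 0 ≤ extend v (x t) t - p t

/-- Lebesgue measure on the type space `[t₀, t₁]`. -/
def typeVolume (t₀ t₁ : ℝ) : Measure (Set.Icc t₀ t₁) := volume.comap Subtype.val

/-- The expectation of `h` when the type has density `f` on `[t₀, t₁]`. -/
def expect {t₀ t₁ : ℝ} (f h : Set.Icc t₀ t₁ → ℝ) : ℝ := ∫ t, h t * f t ∂typeVolume t₀ t₁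

/-- The principal's objective: expected welfare weighted by `lam` plus expected revenue, where the
type has density `f` on `[t₀, t₁]`. -/
def objective {X : Type*} {t₀ t₁ : ℝ} (v : X → Set.Icc t₀ t₁ → ℝ) (f lam : Set.Icc t₀ t₁ → ℝ)
    (x : Set.Icc t₀ t₁ → WithOutside X) (p : Set.Icc t₀ t₁ → ℝ) : ℝ :=
  expect f (fun t => lam t * (extend v (x t) t - p t)) + expect f p

/-- A mechanism that is optimal among all mechanisms. -/
def IsOptimalMechanism {X : Type*} [MeasurableSpace X] {t₀ t₁ : ℝ} (v : X → Set.Icc t₀ t₁ → ℝ)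
    (f lam : Set.Icc t₀ t₁ → ℝ) (x : Set.Icc t₀ t₁ → WithOutside X)
    (p : Set.Icc t₀ t₁ → ℝ) : Prop :=
  IsMechanism v x p ∧
    ∀ (x' : Set.Icc t₀ t₁ → WithOutside X) (p' : Set.Icc t₀ t₁ → ℝ),
      IsMechanism v x' p' → objective v f lam x' p' ≤ objective v f lam x p

/-- A menu `Y` (to which the outside option is always added) is optimal if some optimal mechanism
assigns to every type an element of `Y` or the outside option. -/
def IsOptimalMenu {X : Type*} [MeasurableSpace X] {t₀ t₁ : ℝ} (v : X → Set.Icc t₀ t₁ → ℝ)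
    (f lam : Set.Icc t₀ t₁ → ℝ) (Y : Set X) : Prop :=
  ∃ (x : Set.Icc t₀ t₁ → WithOutside X) (p : Set.Icc t₀ t₁ → ℝ),
    IsOptimalMechanism v f lam x p ∧ ∀ t, x t ∈ insert (Sum.inr ()) (Sum.inl '' Y)

/-! ### Allocations that are functions on the unit interval -/

/-- Measurable functions from `[0,1]` to `[0,1]`. -/
def FunAlloc : Type := {x : unitInterval → unitInterval // Measurable x}

namespace FunAlloc

instance : CoeFun FunAlloc (fun _ => unitInterval → unitInterval) := ⟨Subtype.val⟩

theorem measurable_coe (x : FunAlloc) : Measurable fun s => (x s : ℝ) :=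
  measurable_subtype_coe.comp x.2

theorem integrable_abs_sub (x y : FunAlloc) :
    Integrable (fun s : unitInterval => |(x s : ℝ) - y s|) := by
  refine Integrable.of_bound (C := 1)
    (x.measurable_coe.sub y.measurable_coe).norm.aestronglyMeasurable
    (Filter.Eventually.of_forall fun s => ?_)
  have h1 := (x s).2.1
  have h2 := (x s).2.2
  have h3 := (y s).2.1
  have h4 := (y s).2.2
  rw [Real.norm_eq_abs, abs_abs, abs_le]
  constructor <;> linarith

/-- The `L¹` distance with respect to Lebesgue measure. -/
instance : PseudoMetricSpace FunAlloc where
  dist x y := ∫ s : unitInterval, |(x s : ℝ) - y s|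
  dist_self x := by simp
  dist_comm x y := by simp only [abs_sub_comm]
  dist_triangle x y z := by
    rw [← integral_add (integrable_abs_sub x y) (integrable_abs_sub y z)]
    exact integral_mono (integrable_abs_sub x z)
      ((integrable_abs_sub x y).add (integrable_abs_sub y z)) fun s => abs_sub_le _ _ _

instance : MeasurableSpace FunAlloc := borel _

instance : BorelSpace FunAlloc := ⟨rfl⟩

/-- The indicator function of `[0, k]`. -/
def lower (k : unitInterval) : FunAlloc :=
  ⟨(Set.Icc 0 k).indicator 1, measurable_one.indicator measurableSet_Icc⟩

/-- The indicator function of `[k, 1]`. -/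
def upper (k : unitInterval) : FunAlloc :=
  ⟨(Set.Icc k 1).indicator 1, measurable_one.indicator measurableSet_Icc⟩

/-- The value `v(x, t) = ∫ x(s) u(s, t) dG(s)`. -/
def value {t₀ t₁ : ℝ} (G : Measure unitInterval) (u : unitInterval → ℝ → ℝ) (x : FunAlloc)
    (t : Set.Icc t₀ t₁) : ℝ :=
  ∫ s, (x s : ℝ) * u s t ∂G

end FunAlloc

/-- `u` is log-supermodular on `[0,1] × T`. -/
def LogSupermodularOn (u : unitInterval → ℝ → ℝ) (T : Set ℝ) : Prop :=
  ∀ s s' : unitInterval, s ≤ s' → ∀ t ∈ T, ∀ t' ∈ T, t ≤ t' →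
    Real.log (u s t') + Real.log (u s' t) ≤ Real.log (u s t) + Real.log (u s' t')

/-- `u` is log-submodular on `[0,1] × T`. -/
def LogSubmodularOn (u : unitInterval → ℝ → ℝ) (T : Set ℝ) : Prop :=
  ∀ s s' : unitInterval, s ≤ s' → ∀ t ∈ T, ∀ t' ∈ T, t ≤ t' →
    Real.log (u s t) + Real.log (u s' t') ≤ Real.log (u s t') + Real.log (u s' t)

end Screening

end

/-! Regard `s` as an item that an allocation sells with probability `x s` and that type `t` values
at `w s t`. The optimum sells each item separately at its own posted price `w s (b s)`, where the
cutoff `b s` maximizes `postedPayoff`. Log-supermodularity says that the values of later items grow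
relatively faster in the type. Since `lam` is decreasing with mean at most one, posted payoffs then
satisfy single crossing (`postedPayoff_le_of_ratio`), so the optimal cutoffs can be chosen
increasing in `s`. Type `t` buys the items with `b s ≤ t`, a lower set up to a null set, and
incentive compatibility holds item by item (`isMechanism_posted`).

That no mechanism does better (`payoff_le_posted`) is shown on a sample of one type per small cell.
By `exists_lower_le`, each sampled allocation can be exchanged for a lower set worth the same to its
own type and no more to higher types. This may destroy upward incentive constraints, but the
downward ones survive and suffice. Lower sets are totally ordered and their values have increasing
differences in the type, so pooling makes the allocation increasing without loss
(`exists_monotone_payoff_le`). The payoff is then at most its value when the local downward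
constraints bind (`payoff_le_of_downwardIC`): rent beyond that level increases in the type, where
welfare weights are low, so it is worth at least as much as revenue. The resulting bound is linear
in the allocation. For a single item, an increasing 0-1 allocation is a posted price, so the bound
can be compared with the optimal cutoffs item by item (`discrete_payoff_le`). The errors vanish with
the mesh.

The log-submodular case follows by the reflection `s ↦ 1 - s`. -/

noncomputable section

namespace Screening

/-! ### Finitely many types: pooling towards monotone allocations -/

/-- Downward incentive compatibility of the contracts `(k i, p i)`, `i < n`: no type gains by
imitating a lower type. -/
def DownwardIC {K : Type*} (V : K → ℕ → ℝ) (n : ℕ) (k : ℕ → K) (p : ℕ → ℝ) : Prop :=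
  ∀ i j, i ≤ j → j < n → V (k i) j - p i ≤ V (k j) j - p j

/-- Individual rationality of the contracts `(k i, p i)`, `i < n`. -/
def IndivRational {K : Type*} (V : K → ℕ → ℝ) (n : ℕ) (k : ℕ → K) (p : ℕ → ℝ) : Prop :=
  ∀ j, j < n → 0 ≤ V (k j) j - p j

/-- Weighted welfare plus revenue with finitely many types. -/
def payoff {K : Type*} (V : K → ℕ → ℝ) (l a : ℕ → ℝ) (n : ℕ) (k : ℕ → K) (p : ℕ → ℝ) : ℝ :=
  ∑ i ∈ Finset.range n, (l i * (V (k i) i - p i) + a i * p i)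

section Pooling

variable {K : Type*} [LinearOrder K] {V : K → ℕ → ℝ} {l a : ℕ → ℝ}

/-- Pooling step: contracts that are monotone below `i + 1` and constant on `[i, m]`. -/
theorem exists_monotone_of_pooled
    (hVk : ∀ i, Monotone fun k => V k i) (hVi : ∀ k, Monotone (V k))
    (hVd : ∀ k k', k ≤ k' → Monotone fun i => V k' i - V k i)
    (hl : ∀ i, 0 ≤ l i) (ha : ∀ i, 0 ≤ a i) (hla : ∀ i j, i ≤ j → l j * a i ≤ l i * a j)
    {n m : ℕ} (hm : m < n) (i : ℕ) (him : i ≤ m) (k : ℕ → K) (p : ℕ → ℝ)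
    (hic : DownwardIC V n k p) (hir : IndivRational V n k p)
    (hmono : ∀ r s, r ≤ s → s < i → k r ≤ k s)
    (hconst : ∀ r, i ≤ r → r ≤ m → k r = k m ∧ p r = p m) :
    ∃ k' p', DownwardIC V n k' p' ∧ IndivRational V n k' p' ∧
      (∀ r s, r ≤ s → s < m + 1 → k' r ≤ k' s) ∧ payoff V l a n k p ≤ payoff V l a n k' p' := by
  induction i generalizing k p with
  | zero =>
    refine ⟨k, p, hic, hir, fun r s hrs hs => ?_, le_rfl⟩
    rw [(hconst r (Nat.zero_le _) (by omega)).1, (hconst s (Nat.zero_le _) (by omega)).1]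
  | succ i ih =>
    by_cases hk : k i ≤ k m
    · refine ⟨k, p, hic, hir, fun r s hrs hs => ?_, le_rfl⟩
      by_cases hs' : s < i + 1
      · exact hmono r s hrs hs'
      · rw [(hconst s (by omega) (by omega)).1]
        by_cases hr : r < i + 1
        · exact (hmono r i (by omega) (by omega)).trans hk
        · rw [(hconst r (by omega) (by omega)).1]
    · have hk' : k m ≤ k i := le_of_not_ge hk
      -- The pool above `i` now receives less than type `i`, and `P` is the extra payment of `i`.
      -- Type `m` declines the contract of `i`, so the extra value to `m` is at most `P`; increasing
      -- differences pass this bound to all lower types. Hence every type up to `m` weakly prefers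
      -- the pool's contract.
      set P := p i - p m with hP
      have hPm : V (k i) m - V (k m) m ≤ P := by
        have := hic i m (by omega) hm
        linarith
      have hd : ∀ j, j ≤ m → V (k i) j - V (k m) j ≤ P := fun j hj =>
        (hVd _ _ hk' hj).trans hPm
      have hd0 : ∀ j, 0 ≤ V (k i) j - V (k m) j := fun j => sub_nonneg.2 (hVk j hk')
      -- The tested quantity is the payoff change when type `i` moves to the pool's contract: a gain
      -- in rent against a loss in revenue.
      by_cases hψ : 0 ≤ l i * (P - (V (k i) i - V (k m) i)) - a i * P
      · -- type `i` joins the pool above it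
        have key : V (k i) i - p i ≤ V (k m) i - p m := by
          have := hd i (by omega)
          linarith
        have hih := ih (by omega) (Function.update k i (k m)) (Function.update p i (p m))
        refine Exists.imp (fun k' => Exists.imp fun p' h =>
          ⟨h.1, h.2.1, h.2.2.1, le_trans ?_ h.2.2.2⟩) (hih ?_ ?_ ?_ ?_)
        · refine Finset.sum_le_sum fun j _ => ?_
          by_cases hj : j = i
          · subst hj
            simp only [Function.update_self]
            have : l j * (V (k m) j - p m) + a j * p m - (l j * (V (k j) j - p j) + a j * p j)
              = l j * (P - (V (k j) j - V (k m) j)) - a j * P := by rw [hP]; ring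
            linarith
          · simp [Function.update_of_ne hj]
        · intro r s hrs hs
          by_cases h1 : r = i <;> by_cases h2 : s = i
          · subst h1 h2; exact le_rfl
          · subst h1
            simp only [Function.update_self, Function.update_of_ne h2]
            by_cases h3 : m ≤ s
            · exact hic m s h3 hs
            · obtain ⟨e1, e2⟩ := hconst s (by omega) (by omega)
              rw [e1, e2]
          · subst h2
            simp only [Function.update_self, Function.update_of_ne h1]
            exact (hic r s hrs hs).trans key
          · simp only [Function.update_of_ne h1, Function.update_of_ne h2]
            exact hic r s hrs hs
        · intro s hs
          by_cases h2 : s = i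
          · subst h2
            simp only [Function.update_self]
            exact (hir s hs).trans key
          · simp only [Function.update_of_ne h2]
            exact hir s hs
        · intro r s hrs hs
          rw [Function.update_of_ne (by omega), Function.update_of_ne (by omega)]
          exact hmono r s hrs (by omega)
        · intro r hr hrm
          have hmi : m ≠ i := by omega
          rw [Function.update_of_ne hmi, Function.update_of_ne hmi]
          by_cases h1 : r = i
          · subst h1; simp
          · simp only [Function.update_of_ne h1]
            exact hconst r (by omega) hrm
      · -- the pool joins type `i`
        push Not at hψ
        have hP0 : 0 ≤ P := (hd0 m).trans hPm
        -- If `a i` were zero, moving `i` into the pool would cost no revenue and the other case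
        -- would apply.
        have hai : 0 < a i := by
          rcases (ha i).lt_or_eq with h | h
          · exact h
          · exfalso
            have := mul_nonneg (hl i) (sub_nonneg.2 (hd i (by omega)))
            rw [← h] at hψ
            linarith
        -- Compared with `i`, a pooled type `j` gives up less rent by taking the contract of `i` and
        -- has a lower relative welfare weight. So if the revenue `P` outweighs the rent at `i`, it
        -- does so at `j`.
        have hψj : ∀ j, i ≤ j → j ≤ m → l j * (P - (V (k i) j - V (k m) j)) ≤ a j * P := by
          intro j hij hj
          have e1 : 0 ≤ P - (V (k i) j - V (k m) j) := sub_nonneg.2 (hd j hj)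
          have e2 : V (k i) i - V (k m) i ≤ V (k i) j - V (k m) j := hVd _ _ hk' hij
          have e3 := mul_le_mul_of_nonneg_right (hla i j hij) e1
          have e4 : l i * a j * (P - (V (k i) j - V (k m) j)) ≤
              l i * a j * (P - (V (k i) i - V (k m) i)) :=
            mul_le_mul_of_nonneg_left (by linarith) (mul_nonneg (hl i) (ha j))
          have e5 := mul_le_mul_of_nonneg_left (sub_neg.1 hψ).le (ha j)
          refine le_of_mul_le_mul_left ?_ hai
          linarith
        let I : ℕ → Prop := fun r => i < r ∧ r ≤ m
        classical
        refine ⟨fun r => if I r then k i else k r, fun r => if I r then p i else p r,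
          ?_, ?_, ?_, ?_⟩
        · intro r s hrs hs
          by_cases h2 : I s
          · by_cases h1 : I r
            · simp [h1, h2]
            · simp only [h1, h2, if_true, if_false]
              have hri : r ≤ i := by
                by_contra h
                exact h1 ⟨by omega, hrs.trans h2.2⟩
              have e1 := hic r i hri (by omega)
              -- Since `k r ≤ k i`, a type above `i` declines the contract of `r` in favour of that
              -- of `i` whenever `i` does.
              have e2 : V (k i) i - V (k r) i ≤ V (k i) s - V (k r) s :=
                hVd _ _ (hmono r i hri (by omega)) h2.1.le
              linarith
          · by_cases h1 : I r
            · simp only [h1, h2, if_true, if_false]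
              exact hic i s (h1.1.le.trans hrs) hs
            · simp only [h1, h2, if_false]
              exact hic r s hrs hs
        · intro s hs
          by_cases h2 : I s
          · simp only [h2, if_true]
            have := hir i (by omega)
            have := hVi (k i) h2.1.le
            linarith
          · simp only [h2, if_false]
            exact hir s hs
        · intro r s hrs hs
          by_cases h2 : I s <;> by_cases h1 : I r <;> simp only [h1, h2, if_true, if_false]
          · exact le_rfl
          · refine hmono r i ?_ (by omega)
            by_contra h
            exact h1 ⟨by omega, by omega⟩
          · exact absurd ⟨by have := h1.1; omega, by omega⟩ h2
          · refine hmono r s hrs ?_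
            by_contra h
            exact h2 ⟨by omega, by omega⟩
        · refine Finset.sum_le_sum fun j _ => ?_
          by_cases h2 : I j
          · simp only [h2, if_true]
            have e := hψj j h2.1.le h2.2
            obtain ⟨e1, e2⟩ := hconst j h2.1 h2.2
            rw [e1, e2]
            have : l j * (V (k i) j - p i) + a j * p i - (l j * (V (k m) j - p m) + a j * p m)
              = a j * P - l j * (P - (V (k i) j - V (k m) j)) := by rw [hP]; ring
            linarith
          · simp [h2]

/-- Downward incentive compatible contracts can be replaced by contracts with a monotone
allocation, without lowering the payoff, if the welfare weights `l i / a i` are decreasing. -/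
theorem exists_monotone_payoff_le
    (hVk : ∀ i, Monotone fun k => V k i) (hVi : ∀ k, Monotone (V k))
    (hVd : ∀ k k', k ≤ k' → Monotone fun i => V k' i - V k i)
    (hl : ∀ i, 0 ≤ l i) (ha : ∀ i, 0 ≤ a i) (hla : ∀ i j, i ≤ j → l j * a i ≤ l i * a j)
    {n : ℕ} (k : ℕ → K) (p : ℕ → ℝ)
    (hic : DownwardIC V n k p) (hir : IndivRational V n k p) :
    ∃ k' p', DownwardIC V n k' p' ∧ IndivRational V n k' p' ∧
      (∀ r s, r ≤ s → s < n → k' r ≤ k' s) ∧ payoff V l a n k p ≤ payoff V l a n k' p' := by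
  suffices H : ∀ m ≤ n, ∃ k' p', DownwardIC V n k' p' ∧ IndivRational V n k' p' ∧
      (∀ r s, r ≤ s → s < m → k' r ≤ k' s) ∧ payoff V l a n k p ≤ payoff V l a n k' p' from
    H n le_rfl
  intro m
  induction m with
  | zero => exact fun _ => ⟨k, p, hic, hir, by simp, le_rfl⟩
  | succ m ih =>
    intro hm
    obtain ⟨k₁, p₁, h1, h2, h3, h4⟩ := ih (by omega)
    obtain ⟨k₂, p₂, g1, g2, g3, g4⟩ := exists_monotone_of_pooled hVk hVi hVd hl ha hla
      (Nat.lt_of_succ_le hm) m le_rfl k₁ p₁ h1 h2 h3 fun r hr hrm => by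
        rw [le_antisymm hrm hr]; exact ⟨rfl, rfl⟩
    exact ⟨k₂, p₂, g1, g2, g3, h4.trans g4⟩

end Pooling

/-! ### Finitely many types: binding local constraints and the decomposition into items -/

/-- A Chebyshev-type inequality for two weight sequences with decreasing ratio. -/
theorem sum_mul_le_sum_mul_of_ratio {l a D : ℕ → ℝ} {n : ℕ} (ha : ∀ i, 0 ≤ a i)
    (hla : ∀ i j, i ≤ j → l j * a i ≤ l i * a j)
    (ha1 : ∑ i ∈ Finset.range n, a i = 1) (hl1 : ∑ i ∈ Finset.range n, l i ≤ 1)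
    (hD0 : ∀ i < n, 0 ≤ D i) (hD : ∀ i j, i ≤ j → j < n → D i ≤ D j) :
    ∑ i ∈ Finset.range n, l i * D i ≤ ∑ i ∈ Finset.range n, a i * D i := by
  -- In the symmetrized double sum the two factors of each term have opposite signs.
  have h1 : ∑ i ∈ Finset.range n, ∑ j ∈ Finset.range n,
      (a i * l j - l i * a j) * (D j - D i) ≤ 0 := by
    refine Finset.sum_nonpos fun i hi => Finset.sum_nonpos fun j hj => ?_
    rw [Finset.mem_range] at hi hj
    rcases le_total i j with h | h
    · exact mul_nonpos_of_nonpos_of_nonneg (by linarith [hla i j h])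
        (sub_nonneg.2 (hD i j h hj))
    · exact mul_nonpos_of_nonneg_of_nonpos (by linarith [hla j i h])
        (sub_nonpos.2 (hD j i h hi))
  have h2 : ∑ i ∈ Finset.range n, ∑ j ∈ Finset.range n,
      (a i * l j - l i * a j) * (D j - D i) =
      2 * ((∑ i ∈ Finset.range n, a i) * (∑ i ∈ Finset.range n, l i * D i) -
        (∑ i ∈ Finset.range n, l i) * (∑ i ∈ Finset.range n, a i * D i)) := by
    have e : ∀ i j, (a i * l j - l i * a j) * (D j - D i) =
      a i * (l j * D j) - l i * (a j * D j) - (a i * D i) * l j + (l i * D i) * a j := by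
      intro i j; ring
    simp only [e, Finset.sum_add_distrib, Finset.sum_sub_distrib, ← Finset.mul_sum,
      ← Finset.sum_mul]
    ring
  have h3 : 0 ≤ ∑ i ∈ Finset.range n, a i * D i :=
    Finset.sum_nonneg fun i hi => mul_nonneg (ha i) (hD0 i (Finset.mem_range.1 hi))
  rw [h2, ha1] at h1
  nlinarith [mul_le_mul_of_nonneg_right hl1 h3]

/-- With downward incentive compatible contracts, the payoff is at most the payoff when all local
downward constraints bind. -/
theorem payoff_le_of_downwardIC {K : Type*} {V : K → ℕ → ℝ} {l a : ℕ → ℝ} {n : ℕ}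
    (ha : ∀ i, 0 ≤ a i) (hla : ∀ i j, i ≤ j → l j * a i ≤ l i * a j)
    (ha1 : ∑ i ∈ Finset.range n, a i = 1) (hl1 : ∑ i ∈ Finset.range n, l i ≤ 1)
    {k : ℕ → K} {p : ℕ → ℝ} (hic : DownwardIC V n k p) (hir : IndivRational V n k p) :
    payoff V l a n k p ≤ ∑ i ∈ Finset.range n, (a i * V (k i) i +
      (l i - a i) * ∑ j ∈ Finset.range i, (V (k j) (j + 1) - V (k j) j)) := by
  -- `R i` is the rent of type `i` when all local downward constraints bind, and `D i` is the rent
  -- beyond it. Turning `D` into revenue changes the payoff by `∑ (a i - l i) * D i`.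
  set R : ℕ → ℝ := fun i => ∑ j ∈ Finset.range i, (V (k j) (j + 1) - V (k j) j) with hR
  set D : ℕ → ℝ := fun i => V (k i) i - p i - R i with hDdef
  have hstep : ∀ i, i + 1 < n → D i ≤ D (i + 1) := by
    intro i hi
    have := hic i (i + 1) (by omega) hi
    simp only [hDdef, hR, Finset.sum_range_succ]
    linarith
  have hD : ∀ i j, i ≤ j → j < n → D i ≤ D j := by
    intro i j hij
    induction j, hij using Nat.le_induction with
    | base => exact fun _ => le_rfl
    | succ j _ ih => exact fun hj => (ih (by omega)).trans (hstep j hj)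
  have hD0 : ∀ i < n, 0 ≤ D i := by
    intro i hi
    refine le_trans ?_ (hD 0 i (Nat.zero_le _) hi)
    have := hir 0 (by omega)
    simpa [hDdef, hR] using this
  have h := sum_mul_le_sum_mul_of_ratio ha hla ha1 hl1 hD0 hD
  rw [← sub_nonneg] at h ⊢
  refine h.trans_eq ?_
  rw [payoff, ← Finset.sum_sub_distrib, ← Finset.sum_sub_distrib]
  refine Finset.sum_congr rfl fun i _ => ?_
  simp only [hDdef]
  ring

/-- An increasing sequence of subsets of an index set `{0, …, n - 1}` given by a predicate: the
payoff from a single item is a posted-price payoff. -/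
theorem item_payoff_eq {l a u χ : ℕ → ℝ} {n b : ℕ} (h0 : ∀ i < b, χ i = 0)
    (h1 : ∀ i, b ≤ i → i < n → χ i = 1) :
    ∑ i ∈ Finset.range n, (a i * (χ i * u i) +
      (l i - a i) * ∑ j ∈ Finset.range i, (χ j * u (j + 1) - χ j * u j)) =
    ∑ i ∈ Finset.range n, if b ≤ i then l i * (u i - u b) + a i * u b else 0 := by
  have hs : ∀ i < n, ∑ j ∈ Finset.range i, (χ j * u (j + 1) - χ j * u j) =
      if b ≤ i then u i - u b else 0 := by
    intro i
    induction i with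
    | zero => intro _; by_cases h : b ≤ 0 <;> simp [h]; simp [Nat.le_zero.1 h]
    | succ i ih =>
      intro hi
      rw [Finset.sum_range_succ, ih (by omega)]
      by_cases hb : b ≤ i
      · rw [if_pos hb, if_pos (by omega), h1 i hb (by omega)]; ring
      · rw [if_neg hb, h0 i (by omega)]
        by_cases hb' : b ≤ i + 1
        · have : b = i + 1 := by omega
          rw [if_pos hb', this]; ring
        · rw [if_neg hb']; ring
  refine Finset.sum_congr rfl fun i hi => ?_
  rw [hs i (Finset.mem_range.1 hi)]
  by_cases hb : b ≤ i
  · rw [if_pos hb, if_pos hb, h1 i hb (Finset.mem_range.1 hi)]; ring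
  · rw [if_neg hb, if_neg hb, h0 i (by omega)]; ring

/-! ### Posted prices for a single item -/

section PostedPrice

variable {t₀ t₁ : ℝ}

theorem abs_le_of_antitone (ht : t₀ ≤ t₁) {lam : Set.Icc t₀ t₁ → ℝ} (hlam_nonneg : ∀ t, 0 ≤ lam t)
    (hlam_anti : Antitone lam) (t : Set.Icc t₀ t₁) : |lam t| ≤ lam ⟨t₀, Set.left_mem_Icc.2 ht⟩ := by
  rw [abs_of_nonneg (hlam_nonneg t)]
  exact hlam_anti (Subtype.coe_le_coe.1 t.2.1)

theorem integrable_of_abs_le {α : Type*} [MeasurableSpace α] {μ : Measure α} [IsFiniteMeasure μ]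
    {g : α → ℝ} (hg : Measurable g) {C : ℝ} (hC : ∀ t, |g t| ≤ C) : Integrable g μ :=
  Integrable.of_bound hg.aestronglyMeasurable C (Filter.Eventually.of_forall hC)

/-- The total weight of revenue net of welfare on the types above `b` is nonnegative. -/
theorem setIntegral_one_sub_nonneg {μ : Measure (Set.Icc t₀ t₁)} [IsProbabilityMeasure μ]
    {lam : Set.Icc t₀ t₁ → ℝ} (hlam_anti : Antitone lam) (hlam_int : Integrable lam μ)
    (hlam_mean : ∫ t, lam t ∂μ ≤ 1) (b : Set.Icc t₀ t₁) :
    0 ≤ ∫ t in Set.Ici b, (1 - lam t) ∂μ := by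
  have hint : Integrable (fun t => 1 - lam t) μ := (integrable_const 1).sub hlam_int
  -- If `lam b > 1`, then `1 - lam` is negative below `b`, so the integral above `b` is at least the
  -- total integral, which is nonnegative by the mean condition.
  by_cases hb : lam b ≤ 1
  · exact setIntegral_nonneg measurableSet_Ici fun t htb => sub_nonneg.2 ((hlam_anti htb).trans hb)
  · have h := integral_add_compl (measurableSet_Ici (a := b)) hint
    have h1 : ∫ t, (1 - lam t) ∂μ = 1 - ∫ t, lam t ∂μ := by
      rw [integral_sub (integrable_const 1) hlam_int]; simp
    have h2 : ∫ t in (Set.Ici b)ᶜ, (1 - lam t) ∂μ ≤ 0 := by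
      refine setIntegral_nonpos measurableSet_Ici.compl fun t htb => ?_
      rw [Set.mem_compl_iff, Set.mem_Ici, not_le] at htb
      have := hlam_anti htb.le
      linarith
    linarith

/-- The principal's payoff from selling an item that type `t` values at `g t` at the price `g b`
to all types above `b`. -/
def postedPayoff (μ : Measure (Set.Icc t₀ t₁)) (lam g : Set.Icc t₀ t₁ → ℝ) (b : Set.Icc t₀ t₁) :
    ℝ :=
  ∫ t, (Set.Ici b).indicator (fun t => lam t * (g t - g b) + g b) t ∂μ

theorem postedPayoff_eq {μ : Measure (Set.Icc t₀ t₁)} [IsProbabilityMeasure μ]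
    {lam g : Set.Icc t₀ t₁ → ℝ} (hlam_int : Integrable lam μ)
    (hlg : Integrable (fun t => lam t * g t) μ) (b : Set.Icc t₀ t₁) :
    postedPayoff μ lam g b =
      (∫ t in Set.Ici b, lam t * g t ∂μ) + g b * ∫ t in Set.Ici b, (1 - lam t) ∂μ := by
  have hint : Integrable (fun t => g b * (1 - lam t)) μ :=
    ((integrable_const 1).sub hlam_int).const_mul _
  rw [postedPayoff, integral_indicator measurableSet_Ici, ← integral_const_mul,
    ← integral_add hlg.integrableOn hint.integrableOn]
  refine integral_congr_ae (Filter.Eventually.of_forall fun t => ?_)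
  simp only
  ring

/-- Dominated convergence: at `b₀`, the integrand is discontinuous in the cutoff only for the type
`t = b₀`, a null event. -/
theorem continuous_postedPayoff {μ : Measure (Set.Icc t₀ t₁)} [IsProbabilityMeasure μ]
    [NullSingletonClass μ] {lam g : Set.Icc t₀ t₁ → ℝ} (hlam_meas : Measurable lam) {L C : ℝ}
    (hL : ∀ t, |lam t| ≤ L) (hg : Continuous g) (hC : ∀ t, |g t| ≤ C) :
    Continuous (postedPayoff μ lam g) := by
  refine continuous_iff_continuousAt.2 fun b₀ => ?_
  refine continuousAt_of_dominated (bound := fun _ => L * (2 * C) + C) ?_ ?_ (integrable_const _) ?_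
  · refine Filter.Eventually.of_forall fun b => Measurable.aestronglyMeasurable ?_
    exact ((hlam_meas.mul (hg.measurable.sub_const _)).add_const _).indicator measurableSet_Ici
  · refine Filter.Eventually.of_forall fun b => Filter.Eventually.of_forall fun t => ?_
    refine (norm_indicator_le_norm_self _ _).trans ?_
    rw [Real.norm_eq_abs]
    have h1 : |g t - g b| ≤ 2 * C := (abs_sub _ _).trans (by linarith [hC t, hC b])
    calc |lam t * (g t - g b) + g b| ≤ |lam t| * |g t - g b| + |g b| := by
          rw [← abs_mul]; exact abs_add_le _ _
      _ ≤ L * (2 * C) + C := by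
          gcongr
          · exact (abs_nonneg _).trans (hL t)
          · exact hL t
          · exact hC b
  · have hne : ∀ᵐ t ∂μ, t ≠ b₀ := by
      rw [ae_iff]; simp
    filter_upwards [hne] with t htb
    rcases lt_or_gt_of_ne htb with h | h
    · refine continuousAt_const.congr (f := fun _ => (0 : ℝ)) ?_
      filter_upwards [eventually_gt_nhds h] with b hb
      rw [Set.indicator_of_notMem]
      simpa using hb
    · have hc : ContinuousAt (fun b => lam t * (g t - g b) + g b) b₀ := by fun_prop
      refine hc.congr ?_
      filter_upwards [eventually_lt_nhds h] with b hb
      rw [Set.indicator_of_mem]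
      exact hb.le

/-- Single crossing of posted-price payoffs: if the value of the first item grows relatively less
than that of the second, then a low cutoff is good for the first if it is good for the second. -/
theorem postedPayoff_le_of_ratio {μ : Measure (Set.Icc t₀ t₁)} [IsProbabilityMeasure μ]
    {lam g g' : Set.Icc t₀ t₁ → ℝ} (hlam_nonneg : ∀ t, 0 ≤ lam t) (hlam_anti : Antitone lam)
    (hlam_int : Integrable lam μ) (hlam_mean : ∫ t, lam t ∂μ ≤ 1)
    (hlg : Integrable (fun t => lam t * g t) μ) (hlg' : Integrable (fun t => lam t * g' t) μ)
    (hg : ∀ t, 0 < g t) (hg' : ∀ t, 0 < g' t)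
    (hratio : ∀ t t', t ≤ t' → g t' * g' t ≤ g t * g' t') {b' b : Set.Icc t₀ t₁} (hb : b' ≤ b)
    (h : postedPayoff μ lam g' b ≤ postedPayoff μ lam g' b') :
    postedPayoff μ lam g b ≤ postedPayoff μ lam g b' := by
  have hsplit : ∀ {q : Set.Icc t₀ t₁ → ℝ}, Integrable q μ →
      ∫ t in Set.Ici b', q t ∂μ = (∫ t in Set.Ico b' b, q t ∂μ) + ∫ t in Set.Ici b, q t ∂μ := by
    intro q hq
    rw [← Set.Ico_union_Ici_eq_Ici hb, setIntegral_union ?_ measurableSet_Ici hq.integrableOn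
      hq.integrableOn]
    rw [Set.disjoint_left]
    exact fun t h1 h2 => not_le.2 h1.2 h2
  rw [postedPayoff_eq hlam_int hlg, postedPayoff_eq hlam_int hlg, hsplit hlg]
  rw [postedPayoff_eq hlam_int hlg', postedPayoff_eq hlam_int hlg', hsplit hlg'] at h
  have hL := setIntegral_one_sub_nonneg hlam_anti hlam_int hlam_mean b'
  set Λ' := ∫ t in Set.Ici b', (1 - lam t) ∂μ
  set Λ := ∫ t in Set.Ici b, (1 - lam t) ∂μ
  -- The gain from lowering the cutoff from `b` to `b'`, multiplied by `g' b` for the first item,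
  -- dominates that for the second multiplied by `g b`. `hI` compares the welfare of the added types
  -- and `hJ` the price terms at `b'`, where the sign of `Λ'` matters; the price terms at `b` agree.
  have hI : g b * ∫ t in Set.Ico b' b, lam t * g' t ∂μ ≤
      g' b * ∫ t in Set.Ico b' b, lam t * g t ∂μ := by
    rw [← integral_const_mul, ← integral_const_mul]
    refine setIntegral_mono_on (hlg'.const_mul _).integrableOn (hlg.const_mul _).integrableOn
      measurableSet_Ico fun t htb => ?_
    have := mul_le_mul_of_nonneg_left (hratio t b htb.2.le) (hlam_nonneg t)
    linarith
  have hJ := mul_le_mul_of_nonneg_right (hratio b' b hb) hL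
  have hK := mul_le_mul_of_nonneg_left h (hg b).le
  refine le_of_mul_le_mul_left ?_ (hg' b)
  linarith

/-- Taking the smallest maximizer breaks ties consistently across items, which lets weak single
crossing yield monotone cutoffs. -/
theorem exists_smallest_maximizer (ht : t₀ ≤ t₁) {φ : Set.Icc t₀ t₁ → ℝ} (hφ : Continuous φ) :
    ∃ b, (∀ b', φ b' ≤ φ b) ∧ ∀ b' < b, φ b' < φ b := by
  have : Nonempty (Set.Icc t₀ t₁) := ⟨⟨t₀, Set.left_mem_Icc.2 ht⟩⟩
  obtain ⟨m, -, hm⟩ := isCompact_univ.exists_isMaxOn Set.univ_nonempty hφ.continuousOn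
  have hm' : ∀ b, φ b ≤ φ m := fun b => hm (Set.mem_univ b)
  have hcl : IsClosed {b | φ m ≤ φ b} := isClosed_le continuous_const hφ
  obtain ⟨b, hb, hbl⟩ := hcl.isCompact.exists_isLeast ⟨m, le_refl (φ m)⟩
  refine ⟨b, fun b' => (hm' b').trans hb, fun b' hb' => ?_⟩
  by_contra hcon
  exact absurd (hbl (show φ m ≤ φ b' from hb.trans (not_lt.1 hcon))) (not_le.2 hb')

end PostedPrice

/-! ### Item values -/

/-- `w s t` is the value of the item `s` to type `t`: positive, bounded, increasing and uniformly
Lipschitz in the type. -/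
structure ItemValues {t₀ t₁ : ℝ} (w : unitInterval → Set.Icc t₀ t₁ → ℝ) (B M : ℝ) : Prop where
  meas : Measurable fun z : unitInterval × Set.Icc t₀ t₁ => w z.1 z.2
  pos : ∀ s t, 0 < w s t
  le : ∀ s t, w s t ≤ B
  lip : ∀ s t t', |w s t - w s t'| ≤ M * |(t : ℝ) - t'|
  mono : ∀ s, Monotone (w s)

/-- Items with a larger index have values that grow relatively more. -/
def RatioMonotone {t₀ t₁ : ℝ} (w : unitInterval → Set.Icc t₀ t₁ → ℝ) : Prop :=
  ∀ s s' : unitInterval, s ≤ s' → ∀ t t' : Set.Icc t₀ t₁, t ≤ t' →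
    w s t' * w s' t ≤ w s t * w s' t'

namespace ItemValues

variable {t₀ t₁ B M : ℝ} {w : unitInterval → Set.Icc t₀ t₁ → ℝ}

theorem abs_le (hw : ItemValues w B M) (s : unitInterval) (t : Set.Icc t₀ t₁) : |w s t| ≤ B := by
  rw [abs_of_pos (hw.pos s t)]; exact hw.le s t

theorem measurable_left (hw : ItemValues w B M) (t : Set.Icc t₀ t₁) :
    Measurable fun s => w s t :=
  hw.meas.comp (measurable_id.prodMk measurable_const)

theorem measurable_right (hw : ItemValues w B M) (s : unitInterval) : Measurable (w s) :=
  hw.meas.comp (measurable_const.prodMk measurable_id)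

theorem continuous (hw : ItemValues w B M) (s : unitInterval) : Continuous (w s) := by
  refine (LipschitzWith.of_dist_le' (K := M) fun t t' => ?_).continuous
  rw [Real.dist_eq, Subtype.dist_eq, Real.dist_eq]
  exact hw.lip s t t'

theorem integrable (hw : ItemValues w B M) (G : Measure unitInterval) [IsFiniteMeasure G]
    (t : Set.Icc t₀ t₁) : Integrable (fun s => w s t) G :=
  integrable_of_abs_le (hw.measurable_left t) fun s => hw.abs_le s t

/-- Optimal cutoffs for posted prices, increasing in the item. -/
theorem exists_monotone_cutoff (hw : ItemValues w B M) (hr : RatioMonotone w) (ht : t₀ ≤ t₁)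
    {μ : Measure (Set.Icc t₀ t₁)} [IsProbabilityMeasure μ] [NullSingletonClass μ]
    {lam : Set.Icc t₀ t₁ → ℝ} (hlam_nonneg : ∀ t, 0 ≤ lam t) (hlam_anti : Antitone lam)
    (hlam_mean : ∫ t, lam t ∂μ ≤ 1) :
    ∃ b : unitInterval → Set.Icc t₀ t₁, Monotone b ∧
      ∀ s b', postedPayoff μ lam (w s) b' ≤ postedPayoff μ lam (w s) (b s) := by
  have hL := abs_le_of_antitone ht hlam_nonneg hlam_anti
  have hlam_meas : Measurable lam := hlam_anti.measurable
  have hlam_int : Integrable lam μ := integrable_of_abs_le hlam_meas hL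
  have hlg : ∀ s, Integrable (fun t => lam t * w s t) μ := fun s =>
    hlam_int.mul_bdd (hw.measurable_right s).aestronglyMeasurable
      (Filter.Eventually.of_forall fun t => hw.abs_le s t)
  choose b hb hb' using fun s => exists_smallest_maximizer ht
    (continuous_postedPayoff (μ := μ) hlam_meas hL (hw.continuous s) (hw.abs_le s))
  refine ⟨b, fun s s' hs => ?_, hb⟩
  by_contra hcon
  rw [not_le] at hcon
  -- The smaller cutoff `b s'` beats `b s` for item `s'`, hence weakly for `s`, contradicting that
  -- `b s` is the smallest maximizer for `s`.
  refine absurd (hb' s _ hcon) (not_lt.2 ?_)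
  exact postedPayoff_le_of_ratio hlam_nonneg hlam_anti hlam_int hlam_mean (hlg s) (hlg s')
    (hw.pos s) (hw.pos s') (hr s s' hs) hcon.le (hb s' _)

end ItemValues

/-- The value `∫ x(s) w(s, t) dG(s)` of an allocation. -/
def allocValue {t₀ t₁ : ℝ} (G : Measure unitInterval) (w : unitInterval → Set.Icc t₀ t₁ → ℝ)
    (x : FunAlloc) (t : Set.Icc t₀ t₁) : ℝ :=
  ∫ s, (x s : ℝ) * w s t ∂G

/-! ### Lower sets as allocations, and their comparison with arbitrary allocations -/

namespace FunAlloc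

theorem lower_coe (k s : unitInterval) :
    ((lower k s : unitInterval) : ℝ) = (Set.Icc 0 k).indicator (fun _ => (1 : ℝ)) s := by
  change (((Set.Icc 0 k).indicator 1 s : unitInterval) : ℝ) = _
  by_cases h : s ∈ Set.Icc 0 k <;> simp [h, Set.indicator]

theorem lower_mul (k s : unitInterval) (c : ℝ) :
    ((lower k s : unitInterval) : ℝ) * c = if s ≤ k then c else 0 := by
  rw [lower_coe]
  by_cases h : s ≤ k
  · rw [Set.indicator_of_mem (show s ∈ Set.Icc 0 k from ⟨unitInterval.nonneg', h⟩), if_pos h, one_mul]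
  · rw [Set.indicator_of_notMem (fun h' => h h'.2), if_neg h, zero_mul]

theorem dist_lower_le (k k' : unitInterval) : dist (lower k) (lower k') ≤ dist k k' := by
  wlog h : k ≤ k' generalizing k k'
  · rw [dist_comm, dist_comm k]
    exact this k' k (le_of_not_ge h)
  have h1 : ∀ s, |((lower k s : unitInterval) : ℝ) - lower k' s| =
      (Set.Ioc k k').indicator (fun _ => (1 : ℝ)) s := by
    intro s
    have e1 := lower_mul k s 1
    have e2 := lower_mul k' s 1
    rw [mul_one] at e1 e2
    rw [e1, e2]
    by_cases h1 : s ≤ k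
    · rw [if_pos h1, if_pos (h1.trans h), Set.indicator_of_notMem (fun h' => not_lt.2 h1 h'.1)]
      simp
    · by_cases h2 : s ≤ k'
      · rw [if_neg h1, if_pos h2, Set.indicator_of_mem (show s ∈ Set.Ioc k k' from ⟨not_le.1 h1, h2⟩)]; simp
      · rw [if_neg h1, if_neg h2, Set.indicator_of_notMem (fun h' => h2 h'.2)]; simp
  change ∫ s, |((lower k s : unitInterval) : ℝ) - lower k' s| ≤ _
  simp_rw [h1]
  rw [integral_indicator measurableSet_Ioc, setIntegral_const, Measure.real,
    unitInterval.volume_Ioc, ENNReal.toReal_ofReal (sub_nonneg.2 h), smul_eq_mul, mul_one,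
    dist_comm, Subtype.dist_eq, Real.dist_eq]
  exact le_abs_self _

/-- The Lipschitz bound in the `L¹` distance gives Borel measurability, needed for the posted
allocation to be a measurable map. -/
theorem measurable_lower : Measurable lower := by
  have h : LipschitzWith 1 lower := LipschitzWith.mk_one dist_lower_le
  exact h.continuous.measurable

theorem coe_nonneg (x : FunAlloc) (s : unitInterval) : (0 : ℝ) ≤ x s := (x s).2.1

theorem coe_le_one (x : FunAlloc) (s : unitInterval) : (x s : ℝ) ≤ 1 := (x s).2.2

end FunAlloc

namespace ItemValues

variable {t₀ t₁ B M : ℝ} {w : unitInterval → Set.Icc t₀ t₁ → ℝ} {G : Measure unitInterval}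

theorem allocValue_nonneg (hw : ItemValues w B M) (x : FunAlloc) (t : Set.Icc t₀ t₁) :
    0 ≤ allocValue G w x t :=
  integral_nonneg fun s => mul_nonneg (x.coe_nonneg s) (hw.pos s t).le

theorem abs_alloc_mul_le (hw : ItemValues w B M) (x : FunAlloc) (s : unitInterval)
    (t : Set.Icc t₀ t₁) : |(x s : ℝ) * w s t| ≤ B := by
  rw [abs_mul, abs_of_nonneg (x.coe_nonneg s)]
  calc (x s : ℝ) * |w s t| ≤ 1 * |w s t| :=
        mul_le_mul_of_nonneg_right (x.coe_le_one s) (abs_nonneg _)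
    _ ≤ B := by rw [one_mul]; exact hw.abs_le s t

theorem allocValue_lower (w : unitInterval → Set.Icc t₀ t₁ → ℝ) (G : Measure unitInterval)
    (k : unitInterval) (t : Set.Icc t₀ t₁) :
    allocValue G w (FunAlloc.lower k) t = ∫ s in Set.Iic k, w s t ∂G := by
  rw [allocValue, ← integral_indicator measurableSet_Iic]
  simp_rw [FunAlloc.lower_mul]
  rfl

theorem allocValue_lower_zero [NullSingletonClass G] (w : unitInterval → Set.Icc t₀ t₁ → ℝ)
    (t : Set.Icc t₀ t₁) : allocValue G w (FunAlloc.lower 0) t = 0 := by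
  rw [allocValue_lower]
  have : Set.Iic (0 : unitInterval) = {0} := by
    ext s
    exact ⟨fun h => le_antisymm h unitInterval.nonneg', fun h => h.le⟩
  rw [this, Measure.restrict_singleton]
  simp

variable [IsFiniteMeasure G]

theorem integrable_alloc_mul (hw : ItemValues w B M) (x : FunAlloc) (t : Set.Icc t₀ t₁) :
    Integrable (fun s => (x s : ℝ) * w s t) G :=
  integrable_of_abs_le (x.measurable_coe.mul (hw.measurable_left t))
    fun s => hw.abs_alloc_mul_le x s t

theorem abs_allocValue_le (hw : ItemValues w B M) (x : FunAlloc) (t : Set.Icc t₀ t₁) :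
    |allocValue G w x t| ≤ B * G.real Set.univ :=
  norm_integral_le_of_norm_le_const (f := fun s => (x s : ℝ) * w s t) (C := B)
    (Filter.Eventually.of_forall fun s => hw.abs_alloc_mul_le x s t)

theorem abs_allocValue_sub_le (hw : ItemValues w B M) (x : FunAlloc) (t t' : Set.Icc t₀ t₁) :
    |allocValue G w x t - allocValue G w x t'| ≤ M * |(t : ℝ) - t'| * G.real Set.univ := by
  rw [allocValue, allocValue, ← integral_sub (hw.integrable_alloc_mul x t)
    (hw.integrable_alloc_mul x t')]
  refine norm_integral_le_of_norm_le_const (μ := G)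
    (f := fun s => (x s : ℝ) * w s t - (x s : ℝ) * w s t') (C := M * |(t : ℝ) - t'|)
    (Filter.Eventually.of_forall fun s => ?_)
  rw [← mul_sub, Real.norm_eq_abs, abs_mul, abs_of_nonneg (x.coe_nonneg s)]
  calc (x s : ℝ) * |w s t - w s t'| ≤ 1 * |w s t - w s t'| :=
        mul_le_mul_of_nonneg_right (x.coe_le_one s) (abs_nonneg _)
    _ ≤ _ := by rw [one_mul]; exact hw.lip s t t'

theorem allocValue_lower_sub (hw : ItemValues w B M) {k k' : unitInterval} (hk : k ≤ k')
    (t : Set.Icc t₀ t₁) :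
    allocValue G w (FunAlloc.lower k') t - allocValue G w (FunAlloc.lower k) t =
      ∫ s in Set.Ioc k k', w s t ∂G := by
  rw [allocValue_lower, allocValue_lower, ← Set.Iic_union_Ioc_eq_Iic hk,
    setIntegral_union ?_ measurableSet_Ioc (hw.integrable G t).integrableOn
      (hw.integrable G t).integrableOn]
  · ring
  · rw [Set.disjoint_left]
    exact fun t h1 h2 => not_le.2 h2.1 h1

theorem continuous_allocValue_lower [NullSingletonClass G] (hw : ItemValues w B M)
    (t : Set.Icc t₀ t₁) : Continuous fun k => allocValue G w (FunAlloc.lower k) t := by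
  refine continuous_iff_continuousAt.2 fun k₀ => ?_
  refine continuousAt_of_dominated (bound := fun _ => B) ?_ ?_ (integrable_const _) ?_
  · exact Filter.Eventually.of_forall fun k => (hw.integrable_alloc_mul _ t).aestronglyMeasurable
  · exact Filter.Eventually.of_forall fun k => Filter.Eventually.of_forall fun s =>
      hw.abs_alloc_mul_le _ s t
  · have hne : ∀ᵐ s ∂G, s ≠ k₀ := by
      rw [ae_iff]; simp
    filter_upwards [hne] with s hs
    simp_rw [FunAlloc.lower_mul]
    rcases lt_or_gt_of_ne hs with h | h
    · refine continuousAt_const.congr (f := fun _ => w s t) ?_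
      filter_upwards [eventually_gt_nhds h] with k hk
      rw [if_pos hk.le]
    · refine continuousAt_const.congr (f := fun _ => (0 : ℝ)) ?_
      filter_upwards [eventually_lt_nhds h] with k hk
      rw [if_neg (not_le.2 hk)]

/-- Every allocation can be replaced by a lower set that has the same value to a given type and a
lower value to all higher types. -/
theorem exists_lower_le [NullSingletonClass G] (hw : ItemValues w B M) (hr : RatioMonotone w)
    (x : FunAlloc) (t : Set.Icc t₀ t₁) :
    ∃ k, allocValue G w (FunAlloc.lower k) t = allocValue G w x t ∧
      ∀ t', t ≤ t' → allocValue G w (FunAlloc.lower k) t' ≤ allocValue G w x t' := by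
  have h1 : allocValue G w x t ≤ allocValue G w (FunAlloc.lower 1) t := by
    refine integral_mono (hw.integrable_alloc_mul _ t) (hw.integrable_alloc_mul _ t) fun s => ?_
    simp only
    rw [FunAlloc.lower_mul, if_pos unitInterval.le_one']
    exact mul_le_of_le_one_left (hw.pos s t).le (x.coe_le_one s)
  obtain ⟨k, hk⟩ := intermediate_value_univ 0 1 (hw.continuous_allocValue_lower (G := G) t)
    ⟨(allocValue_lower_zero w t).le.trans (hw.allocValue_nonneg x t), h1⟩
  refine ⟨k, hk, fun t' ht' => ?_⟩
  have hint : ∀ r, Integrable (fun s => ((FunAlloc.lower k s : unitInterval) : ℝ) * w s r -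
      (x s : ℝ) * w s r) G := fun r =>
    (hw.integrable_alloc_mul _ r).sub (hw.integrable_alloc_mul _ r)
  have hsub : ∀ r, ∫ s, (((FunAlloc.lower k s : unitInterval) : ℝ) * w s r -
      (x s : ℝ) * w s r) ∂G = allocValue G w (FunAlloc.lower k) r - allocValue G w x r := fun r =>
    integral_sub (hw.integrable_alloc_mul _ r) (hw.integrable_alloc_mul _ r)
  -- Passing from `x` to the lower set adds items below `k` and removes items above `k`. From `t` to
  -- `t'` the added ones grow relatively less than item `k` and the removed ones relatively more;
  -- the net value at `t` is zero by the choice of `k`.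
  have key : w k t * (allocValue G w (FunAlloc.lower k) t' - allocValue G w x t') ≤
      w k t' * (allocValue G w (FunAlloc.lower k) t - allocValue G w x t) := by
    rw [← hsub, ← hsub, ← integral_const_mul, ← integral_const_mul]
    refine integral_mono ((hint t').const_mul _) ((hint t).const_mul _) fun s => ?_
    simp only [FunAlloc.lower_mul]
    have hx0 := x.coe_nonneg s
    have hx1 := x.coe_le_one s
    by_cases hs : s ≤ k
    · rw [if_pos hs, if_pos hs]
      have := mul_le_mul_of_nonneg_left (hr s k hs t t' ht') (sub_nonneg.2 hx1)
      linarith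
    · rw [if_neg hs, if_neg hs]
      have := mul_le_mul_of_nonneg_left (hr k s (le_of_not_ge hs) t t' ht') hx0
      linarith
  have hk' : allocValue G w (FunAlloc.lower k) t = allocValue G w x t := hk
  rw [hk', sub_self, mul_zero] at key
  have := nonpos_of_mul_nonpos_right key (hw.pos k t)
  linarith

end ItemValues

/-! ### Selling every item at a posted price -/

section PostedMechanism

variable {t₀ t₁ : ℝ}

/-- The highest item sold to type `t` when the item `s` is sold to the types above `b s`. -/
def cutoffItem (b : unitInterval → Set.Icc t₀ t₁) (t : Set.Icc t₀ t₁) : unitInterval :=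
  sSup {s | b s ≤ t}

/-- The allocation when the item `s` is sold to the types above `b s`. -/
def postedAlloc (b : unitInterval → Set.Icc t₀ t₁) (t : Set.Icc t₀ t₁) : WithOutside FunAlloc :=
  Sum.inl (FunAlloc.lower (cutoffItem b t))

/-- The payment when the item `s` is sold at the price `w s (b s)`. -/
def postedPrice (G : Measure unitInterval) (w : unitInterval → Set.Icc t₀ t₁ → ℝ)
    (b : unitInterval → Set.Icc t₀ t₁) (t : Set.Icc t₀ t₁) : ℝ :=
  ∫ s, if b s ≤ t then w s (b s) else 0 ∂G

/-- The supremum itself may or may not be sold; this single item is null under an atomless measure.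
The empty case is covered too, the supremum then being `0`. -/
theorem le_cutoffItem_iff {b : unitInterval → Set.Icc t₀ t₁} (hb : Monotone b)
    {t : Set.Icc t₀ t₁} {s : unitInterval} (hs : s ≠ cutoffItem b t) :
    s ≤ cutoffItem b t ↔ b s ≤ t := by
  refine ⟨fun h => ?_, fun h => le_sSup h⟩
  obtain ⟨s', hs', hlt⟩ := lt_sSup_iff.1 (lt_of_le_of_ne h hs)
  exact (hb hlt.le).trans hs'

theorem monotone_cutoffItem (b : unitInterval → Set.Icc t₀ t₁) : Monotone (cutoffItem b) :=
  fun _ _ h => sSup_le_sSup fun _ hs => le_trans hs h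

namespace ItemValues

variable {B M : ℝ} {w : unitInterval → Set.Icc t₀ t₁ → ℝ} {G : Measure unitInterval}

theorem extend_postedAlloc [NullSingletonClass G] (w : unitInterval → Set.Icc t₀ t₁ → ℝ)
    {b : unitInterval → Set.Icc t₀ t₁} (hb : Monotone b) (t t' : Set.Icc t₀ t₁) :
    extend (allocValue G w) (postedAlloc b t) t' = ∫ s, if b s ≤ t then w s t' else 0 ∂G := by
  change allocValue G w (FunAlloc.lower (cutoffItem b t)) t' = _
  refine integral_congr_ae ?_
  have hne : ∀ᵐ s ∂G, s ≠ cutoffItem b t := by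
    rw [ae_iff]; simp
  filter_upwards [hne] with s hs
  rw [FunAlloc.lower_mul]
  simp only [le_cutoffItem_iff hb hs]

variable [IsFiniteMeasure G]

theorem measurable_cutoff_value (hw : ItemValues w B M) {b : unitInterval → Set.Icc t₀ t₁}
    (hb : Monotone b) : Measurable fun s => w s (b s) :=
  hw.meas.comp (measurable_id.prodMk hb.measurable)

theorem integrable_posted_value (hw : ItemValues w B M) {b : unitInterval → Set.Icc t₀ t₁}
    (hb : Monotone b) (t t' : Set.Icc t₀ t₁) :
    Integrable (fun s => if b s ≤ t then w s t' else 0) G := by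
  refine integrable_of_abs_le (C := B) ((hw.measurable_left t').ite
    (measurableSet_le hb.measurable measurable_const) measurable_const) fun s => ?_
  split_ifs
  · exact hw.abs_le s t'
  · rw [abs_zero]; exact (abs_nonneg _).trans (hw.abs_le s t')

theorem integrable_posted_price (hw : ItemValues w B M) {b : unitInterval → Set.Icc t₀ t₁}
    (hb : Monotone b) (t : Set.Icc t₀ t₁) :
    Integrable (fun s => if b s ≤ t then w s (b s) else 0) G := by
  refine integrable_of_abs_le (C := B) ((hw.measurable_cutoff_value hb).ite
    (measurableSet_le hb.measurable measurable_const) measurable_const) fun s => ?_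
  split_ifs
  · exact hw.abs_le s _
  · rw [abs_zero]; exact (abs_nonneg _).trans (hw.abs_le s t)

theorem extend_postedAlloc_sub [NullSingletonClass G] (hw : ItemValues w B M)
    {b : unitInterval → Set.Icc t₀ t₁} (hb : Monotone b) (t t' : Set.Icc t₀ t₁) :
    extend (allocValue G w) (postedAlloc b t) t' - postedPrice G w b t =
      ∫ s, if b s ≤ t then w s t' - w s (b s) else 0 ∂G := by
  rw [extend_postedAlloc w hb, postedPrice, ← integral_sub (hw.integrable_posted_value hb t t')
    (hw.integrable_posted_price hb t)]
  refine integral_congr_ae (Filter.Eventually.of_forall fun s => ?_)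
  simp only
  split_ifs <;> ring

theorem integrable_posted_sub (hw : ItemValues w B M)
    {b : unitInterval → Set.Icc t₀ t₁} (hb : Monotone b) (t t' : Set.Icc t₀ t₁) :
    Integrable (fun s => if b s ≤ t then w s t' - w s (b s) else 0) G := by
  refine ((hw.integrable_posted_value hb t t').sub (hw.integrable_posted_price hb t)).congr
    (Filter.Eventually.of_forall fun s => ?_)
  simp only [Pi.sub_apply]
  split_ifs <;> ring

theorem isMechanism_posted [NullSingletonClass G] (hw : ItemValues w B M)
    {b : unitInterval → Set.Icc t₀ t₁} (hb : Monotone b) :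
    IsMechanism (allocValue G w) (postedAlloc b) (postedPrice G w b) where
  measurable := by
    refine Measurable.prodMk ?_ (Monotone.measurable fun t t' htt => ?_)
    · exact measurable_inl.comp
        (FunAlloc.measurable_lower.comp (monotone_cutoffItem b).measurable)
    · refine integral_mono (hw.integrable_posted_price hb t) (hw.integrable_posted_price hb t')
        fun s => ?_
      simp only
      split_ifs with h1 h2 h2
      · exact le_rfl
      · exact absurd (h1.trans htt) h2
      · exact (hw.pos s _).le
      · exact le_rfl
  -- Item by item: a type buys exactly the items with cutoff at most its own, and by monotonicity
  -- these have nonnegative surplus while all others have nonpositive surplus.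
  ic t t' := by
    rw [hw.extend_postedAlloc_sub hb, hw.extend_postedAlloc_sub hb]
    refine integral_mono (hw.integrable_posted_sub hb _ _) (hw.integrable_posted_sub hb _ _)
      fun s => ?_
    simp only
    split_ifs with h1 h2 h2
    · exact le_rfl
    · exact sub_nonpos.2 (hw.mono s (le_of_not_ge h2))
    · exact sub_nonneg.2 (hw.mono s h2)
    · exact le_rfl
  ir t := by
    rw [hw.extend_postedAlloc_sub hb]
    refine integral_nonneg fun s => ?_
    simp only [Pi.zero_apply]
    split_ifs with h
    · exact sub_nonneg.2 (hw.mono s h)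
    · exact le_rfl

/-- Joint integrability over types and items, for the exchange of integrals in `payoff_posted`. -/
theorem integrable_posted_welfare (hw : ItemValues w B M) {b : unitInterval → Set.Icc t₀ t₁}
    (hb : Monotone b) {μ : Measure (Set.Icc t₀ t₁)} [IsProbabilityMeasure μ]
    {lam : Set.Icc t₀ t₁ → ℝ} (hlam_meas : Measurable lam) {L : ℝ} (hL : ∀ t, |lam t| ≤ L) :
    Integrable (fun z : Set.Icc t₀ t₁ × unitInterval =>
      if b z.2 ≤ z.1 then lam z.1 * (w z.2 z.1 - w z.2 (b z.2)) else 0) (μ.prod G) := by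
  refine integrable_of_abs_le (C := L * (2 * B)) (Measurable.ite
    (measurableSet_le (hb.measurable.comp measurable_snd) measurable_fst)
    ((hlam_meas.comp measurable_fst).mul ((hw.meas.comp measurable_swap).sub
      ((hw.measurable_cutoff_value hb).comp measurable_snd))) measurable_const) fun z => ?_
  have hL0 := (abs_nonneg _).trans (hL z.1)
  have hB := (abs_nonneg _).trans (hw.abs_le z.2 z.1)
  split_ifs
  · rw [abs_mul]
    refine mul_le_mul (hL _) ?_ (abs_nonneg _) hL0
    exact (abs_sub _ _).trans (by linarith [hw.abs_le z.2 z.1, hw.abs_le z.2 (b z.2)])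
  · rw [abs_zero]; positivity

theorem integrable_posted_revenue (hw : ItemValues w B M) {b : unitInterval → Set.Icc t₀ t₁}
    (hb : Monotone b) {μ : Measure (Set.Icc t₀ t₁)} [IsProbabilityMeasure μ] :
    Integrable (fun z : Set.Icc t₀ t₁ × unitInterval =>
      if b z.2 ≤ z.1 then w z.2 (b z.2) else 0) (μ.prod G) := by
  refine integrable_of_abs_le (C := B) (Measurable.ite
    (measurableSet_le (hb.measurable.comp measurable_snd) measurable_fst)
    ((hw.measurable_cutoff_value hb).comp measurable_snd) measurable_const) fun z => ?_
  split_ifs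
  · exact hw.abs_le _ _
  · rw [abs_zero]; exact (abs_nonneg _).trans (hw.abs_le z.2 z.1)

theorem postedPayoff_cutoff (hw : ItemValues w B M) {b : unitInterval → Set.Icc t₀ t₁}
    (hb : Monotone b) {μ : Measure (Set.Icc t₀ t₁)} [IsProbabilityMeasure μ]
    {lam : Set.Icc t₀ t₁ → ℝ} (hlam_meas : Measurable lam) {L : ℝ} (hL : ∀ t, |lam t| ≤ L) :
    ∀ᵐ s ∂G, postedPayoff μ lam (w s) (b s) =
      (∫ t, if b s ≤ t then lam t * (w s t - w s (b s)) else 0 ∂μ) +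
        ∫ t, if b s ≤ t then w s (b s) else 0 ∂μ := by
  filter_upwards [(hw.integrable_posted_welfare (G := G) (μ := μ) hb hlam_meas hL).prod_left_ae,
    (hw.integrable_posted_revenue (G := G) (μ := μ) hb).prod_left_ae] with s h1 h2
  rw [← integral_add h1 h2, postedPayoff]
  refine integral_congr_ae (Filter.Eventually.of_forall fun t => ?_)
  by_cases h : b s ≤ t
  · simp [h]
  · simp [h]

theorem integrable_postedPayoff (hw : ItemValues w B M) {b : unitInterval → Set.Icc t₀ t₁}
    (hb : Monotone b) {μ : Measure (Set.Icc t₀ t₁)} [IsProbabilityMeasure μ]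
    {lam : Set.Icc t₀ t₁ → ℝ} (hlam_meas : Measurable lam) {L : ℝ} (hL : ∀ t, |lam t| ≤ L) :
    Integrable (fun s => postedPayoff μ lam (w s) (b s)) G :=
  (((hw.integrable_posted_welfare (μ := μ) hb hlam_meas hL).integral_prod_right).add
    ((hw.integrable_posted_revenue (μ := μ) hb).integral_prod_right)).congr
      ((hw.postedPayoff_cutoff hb hlam_meas hL).mono fun _ h => h.symm)

/-- The payoff of the posted-price mechanism is the sum of the payoffs of its items. -/
theorem payoff_posted [NullSingletonClass G] (hw : ItemValues w B M)
    {b : unitInterval → Set.Icc t₀ t₁}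
    (hb : Monotone b) {μ : Measure (Set.Icc t₀ t₁)} [IsProbabilityMeasure μ]
    {lam : Set.Icc t₀ t₁ → ℝ} (hlam_meas : Measurable lam) {L : ℝ} (hL : ∀ t, |lam t| ≤ L) :
    (∫ t, lam t * (extend (allocValue G w) (postedAlloc b t) t - postedPrice G w b t) ∂μ) +
      ∫ t, postedPrice G w b t ∂μ = ∫ s, postedPayoff μ lam (w s) (b s) ∂G := by
  have h1 := hw.integrable_posted_welfare (G := G) (μ := μ) hb hlam_meas hL
  have h2 := hw.integrable_posted_revenue (G := G) (μ := μ) hb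
  rw [integral_congr_ae (hw.postedPayoff_cutoff hb hlam_meas hL),
    integral_add h1.integral_prod_right h2.integral_prod_right]
  congr 1
  · rw [← integral_integral_swap (f := fun t s =>
      if b s ≤ t then lam t * (w s t - w s (b s)) else 0) h1]
    refine integral_congr_ae (Filter.Eventually.of_forall fun t => ?_)
    simp only
    rw [hw.extend_postedAlloc_sub hb, ← integral_const_mul]
    refine integral_congr_ae (Filter.Eventually.of_forall fun s => ?_)
    simp only [mul_ite, mul_zero]
  · rw [← integral_integral_swap (f := fun t s => if b s ≤ t then w s (b s) else 0) h2]
    rfl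

end ItemValues

end PostedMechanism

/-! ### Discretisation of the type space -/

section Cells

variable {t₀ t₁ : ℝ}

/-- A partition of the type space into the cells `{t | c t = i}`, `i < n`, which are intervals of
length at most `δ` with smallest elements `e i`. -/
structure IsCellPartition (δ : ℝ) (n : ℕ) (c : Set.Icc t₀ t₁ → ℕ) (e : ℕ → Set.Icc t₀ t₁) :
    Prop where
  lt : ∀ t, c t < n
  cell_left : ∀ i < n, c (e i) = i
  le_iff : ∀ i < n, ∀ t, i ≤ c t ↔ e i ≤ t
  abs_sub_le : ∀ t t', c t = c t' → |(t : ℝ) - t'| ≤ δ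

theorem exists_isCellPartition (ht : t₀ < t₁) {δ : ℝ} (hδ : 0 < δ) :
    ∃ (n : ℕ) (c : Set.Icc t₀ t₁ → ℕ) (e : ℕ → Set.Icc t₀ t₁), IsCellPartition δ n c e := by
  have hd : 0 < t₁ - t₀ := sub_pos.2 ht
  obtain ⟨N, hN⟩ := exists_nat_gt ((t₁ - t₀) / δ)
  have hN0 : (0 : ℝ) < N := (div_pos hd hδ).trans hN
  have hNδ : t₁ - t₀ ≤ N * δ := ((div_lt_iff₀ hδ).1 hN).le
  have hr0 : ∀ t : Set.Icc t₀ t₁, 0 ≤ N * ((t : ℝ) - t₀) / (t₁ - t₀) := fun t =>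
    div_nonneg (mul_nonneg hN0.le (sub_nonneg.2 t.2.1)) hd.le
  have hmem : ∀ i : ℕ, i ≤ N → t₀ + i * (t₁ - t₀) / N ∈ Set.Icc t₀ t₁ := by
    intro i hi
    have hi' : (i : ℝ) ≤ N := by exact_mod_cast hi
    refine ⟨by have : 0 ≤ (i : ℝ) * (t₁ - t₀) / N := by positivity
               linarith, ?_⟩
    have : (i : ℝ) * (t₁ - t₀) / N ≤ t₁ - t₀ := by
      rw [div_le_iff₀ hN0, mul_comm]
      exact mul_le_mul_of_nonneg_left hi' hd.le
    linarith
  have hiff : ∀ (i : ℕ) (t : Set.Icc t₀ t₁),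
      i ≤ ⌊N * ((t : ℝ) - t₀) / (t₁ - t₀)⌋₊ ↔ t₀ + i * (t₁ - t₀) / N ≤ t := by
    intro i t
    rw [Nat.le_floor_iff (hr0 t), le_div_iff₀ hd, ← le_sub_iff_add_le', div_le_iff₀ hN0,
      mul_comm (N : ℝ)]
  -- There are `N` half-open cells of equal length and a last cell `{t₁}`, where the floor equals
  -- `N`. The projection only makes the left endpoints total in `i`.
  refine ⟨N + 1, fun t => ⌊N * ((t : ℝ) - t₀) / (t₁ - t₀)⌋₊,
    fun i => Set.projIcc t₀ t₁ ht.le (t₀ + i * (t₁ - t₀) / N), ?_, ?_, ?_, ?_⟩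
  · intro t
    rw [Nat.lt_succ_iff, ← Nat.cast_le (α := ℝ)]
    refine (Nat.floor_le (hr0 t)).trans ?_
    rw [div_le_iff₀ hd]
    exact mul_le_mul_of_nonneg_left (by linarith [t.2.2]) hN0.le
  · intro i hi
    rw [Set.projIcc_of_mem _ (hmem i (by omega))]
    simp only
    have : (N : ℝ) * (t₀ + i * (t₁ - t₀) / N - t₀) / (t₁ - t₀) = i := by
      field_simp
      ring
    rw [this, Nat.floor_natCast]
  · intro i hi t
    rw [hiff, Set.projIcc_of_mem _ (hmem i (by omega))]
    exact Iff.rfl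
  · intro t t' h
    have key : ∀ q q' : Set.Icc t₀ t₁,
        ⌊N * ((q : ℝ) - t₀) / (t₁ - t₀)⌋₊ = ⌊N * ((q' : ℝ) - t₀) / (t₁ - t₀)⌋₊ →
        (q : ℝ) - q' ≤ δ := by
      intro q q' hq
      have h1 := Nat.lt_floor_add_one (N * ((q : ℝ) - t₀) / (t₁ - t₀))
      have h2 := Nat.floor_le (hr0 q')
      rw [hq] at h1
      have h3 : N * ((q : ℝ) - t₀) / (t₁ - t₀) < N * ((q' : ℝ) - t₀) / (t₁ - t₀) + 1 := by
        linarith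
      rw [div_add_one hd.ne', div_lt_div_iff_of_pos_right hd] at h3
      refine le_of_mul_le_mul_left ?_ hN0
      linarith
    exact abs_le.2 ⟨by linarith [key t' t h.symm], key t t' h⟩

namespace IsCellPartition

variable {δ : ℝ} {n : ℕ} {c : Set.Icc t₀ t₁ → ℕ} {e : ℕ → Set.Icc t₀ t₁}

theorem monotone (h : IsCellPartition δ n c e) : Monotone c := fun t t' htt =>
  (h.le_iff _ (h.lt t) t').2 (((h.le_iff _ (h.lt t) t).1 le_rfl).trans htt)

theorem measurableSet_cell (h : IsCellPartition δ n c e) (i : ℕ) :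
    MeasurableSet (c ⁻¹' {i}) :=
  h.monotone.measurable (measurableSet_singleton i)

theorem integral_mul_comp (h : IsCellPartition δ n c e) {μ : Measure (Set.Icc t₀ t₁)}
    {g : Set.Icc t₀ t₁ → ℝ} (hg : Integrable g μ) (q : ℕ → ℝ) :
    ∫ t, g t * q (c t) ∂μ = ∑ i ∈ Finset.range n, (∫ t in c ⁻¹' {i}, g t ∂μ) * q i := by
  have e1 : ∀ t, g t * q (c t) =
      ∑ i ∈ Finset.range n, (c ⁻¹' {i}).indicator (fun t => g t * q i) t := by
    intro t
    rw [Finset.sum_eq_single (c t)]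
    · rw [Set.indicator_of_mem (by simp)]
    · intro i _ hi
      rw [Set.indicator_of_notMem]
      simpa using hi.symm
    · intro hi
      exact absurd (Finset.mem_range.2 (h.lt t)) hi
  simp_rw [e1]
  rw [integral_finsetSum _ fun i _ => (hg.mul_const _).indicator (h.measurableSet_cell i)]
  refine Finset.sum_congr rfl fun i _ => ?_
  rw [integral_indicator (h.measurableSet_cell i), integral_mul_const]

theorem integrable_mul_comp (h : IsCellPartition δ n c e) {μ : Measure (Set.Icc t₀ t₁)}
    {g : Set.Icc t₀ t₁ → ℝ} (hg : Integrable g μ) (q : ℕ → ℝ) :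
    Integrable (fun t => g t * q (c t)) μ := by
  refine hg.mul_bdd (c := ∑ i ∈ Finset.range n, |q i|)
    ((measurable_of_countable q).comp h.monotone.measurable).aestronglyMeasurable
    (Filter.Eventually.of_forall fun t => ?_)
  exact Finset.single_le_sum (f := fun i => |q i|) (fun i _ => abs_nonneg _)
    (Finset.mem_range.2 (h.lt t))

/-- The cell weights of a decreasing function have decreasing ratios to the cell probabilities. -/
theorem ratio_antitone (h : IsCellPartition δ n c e) {μ : Measure (Set.Icc t₀ t₁)}
    [IsProbabilityMeasure μ] {lam : Set.Icc t₀ t₁ → ℝ} (hlam_anti : Antitone lam)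
    (hlam_int : Integrable lam μ) {i j : ℕ} (hij : i ≤ j) :
    (∫ t in c ⁻¹' {j}, lam t ∂μ) * ∫ _t in c ⁻¹' {i}, (1 : ℝ) ∂μ ≤
      (∫ t in c ⁻¹' {i}, lam t ∂μ) * ∫ _t in c ⁻¹' {j}, (1 : ℝ) ∂μ := by
  rcases hij.eq_or_lt with rfl | hij
  · exact le_rfl
  by_cases hj : j < n
  · have ha : ∀ i, 0 ≤ ∫ _t in c ⁻¹' {i}, (1 : ℝ) ∂μ := fun i => integral_nonneg fun _ => zero_le_one
    have e1 : ∀ i, lam (e j) * ∫ _t in c ⁻¹' {i}, (1 : ℝ) ∂μ =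
        ∫ _t in c ⁻¹' {i}, lam (e j) ∂μ := fun i => by
      rw [← integral_const_mul]; simp
    -- The value `lam (e j)` separates the two cells: it bounds `lam` above on cell `j` and below on
    -- cell `i`.
    have h1 : (∫ t in c ⁻¹' {j}, lam t ∂μ) ≤ lam (e j) * ∫ _t in c ⁻¹' {j}, (1 : ℝ) ∂μ := by
      rw [e1]
      refine setIntegral_mono_on hlam_int.integrableOn (integrable_const _).integrableOn
        (h.measurableSet_cell j) fun t htj => hlam_anti ((h.le_iff j hj t).1 (le_of_eq ?_))
      exact (show c t = j from htj).symm
    have h2 : lam (e j) * ∫ _t in c ⁻¹' {i}, (1 : ℝ) ∂μ ≤ ∫ t in c ⁻¹' {i}, lam t ∂μ := by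
      rw [e1]
      refine setIntegral_mono_on (integrable_const _).integrableOn hlam_int.integrableOn
        (h.measurableSet_cell i) fun t hti => hlam_anti (le_of_not_ge fun hcon => ?_)
      have := (h.le_iff j hj t).2 hcon
      rw [show c t = i from hti] at this
      omega
    have h3 := mul_le_mul_of_nonneg_right h1 (ha i)
    have h4 := mul_le_mul_of_nonneg_right h2 (ha j)
    linarith
  · have hempty : c ⁻¹' {j} = ∅ := by
      ext t
      have := h.lt t
      simp only [Set.mem_preimage, Set.mem_singleton_iff, Set.mem_empty_iff_false, iff_false]
      omega
    simp [hempty]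

/-- Representatives of the cells at which a given bounded function is nearly maximal. -/
theorem exists_representatives (h : IsCellPartition δ n c e) {p : Set.Icc t₀ t₁ → ℝ} {C : ℝ}
    (hp : ∀ t, p t ≤ C) {ε : ℝ} (hε : 0 < ε) (hn : 0 < n) :
    ∃ τ : ℕ → Set.Icc t₀ t₁, Monotone τ ∧ (∀ i < n, c (τ i) = i) ∧
      ∀ t, p t ≤ p (τ (c t)) + ε := by
  have h1 : ∀ i, ∃ q, i < n → c q = i ∧ ∀ t, c t = i → p t ≤ p q + ε := by
    intro i
    by_cases hi : i < n
    · have hne : (p '' (c ⁻¹' {i})).Nonempty := ⟨p (e i), e i, h.cell_left i hi, rfl⟩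
      have hbd : BddAbove (p '' (c ⁻¹' {i})) := ⟨C, by rintro _ ⟨t, -, rfl⟩; exact hp t⟩
      obtain ⟨_, ⟨q, hq, rfl⟩, hlt⟩ := exists_lt_of_lt_csSup hne
        (show sSup (p '' (c ⁻¹' {i})) - ε < sSup (p '' (c ⁻¹' {i})) by linarith)
      refine ⟨q, fun _ => ⟨hq, fun t hti => ?_⟩⟩
      have := le_csSup hbd ⟨t, hti, rfl⟩
      linarith
    · exact ⟨e 0, fun h => absurd h hi⟩
  choose τ hτ using h1
  -- Freezing the index at `n - 1` makes the representatives monotone on all of `ℕ`, as the pooling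
  -- lemma requires.
  refine ⟨fun i => τ (min i (n - 1)), fun i j hij => ?_, fun i hi => ?_, fun t => ?_⟩
  · rcases (min_le_min_right (n - 1) hij).eq_or_lt with heq | hlt
    · simp only [heq, le_refl]
    · refine le_of_not_gt fun hcon => not_lt.2 (h.monotone hcon.le) ?_
      rw [(hτ _ (by omega)).1, (hτ _ (by omega)).1]
      exact hlt
  · have : min i (n - 1) = i := by omega
    simp only [this]
    exact (hτ i hi).1
  · have hlt := h.lt t
    have : min (c t) (n - 1) = c t := by omega
    simp only [this]
    exact (hτ _ hlt).2 t rfl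

end IsCellPartition

end Cells

/-! ### The upper bound -/

namespace ItemValues

variable {t₀ t₁ B M : ℝ} {w : unitInterval → Set.Icc t₀ t₁ → ℝ} {G : Measure unitInterval}

section Discretised

variable {δ : ℝ} {n : ℕ} {c : Set.Icc t₀ t₁ → ℕ} {e : ℕ → Set.Icc t₀ t₁}
  {μ : Measure (Set.Icc t₀ t₁)} [IsProbabilityMeasure μ] {lam : Set.Icc t₀ t₁ → ℝ}

/-- A posted price with finitely many types is worth little more than with all types. -/
theorem discrete_postedPayoff_le (hw : ItemValues w B M) (hM : 0 ≤ M)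
    (hc : IsCellPartition δ n c e) (hδ : 0 ≤ δ)
    (hlam_nonneg : ∀ t, 0 ≤ lam t) (hlam_int : Integrable lam μ) (hlam_mean : ∫ t, lam t ∂μ ≤ 1)
    {τ : ℕ → Set.Icc t₀ t₁} (hτ : ∀ i < n, c (τ i) = i) (s : unitInterval) {b : ℕ} (hb : b < n) :
    (∑ i ∈ Finset.range n, if b ≤ i then (∫ t in c ⁻¹' {i}, lam t ∂μ) * (w s (τ i) - w s (τ b)) +
      (∫ _t in c ⁻¹' {i}, (1 : ℝ) ∂μ) * w s (τ b) else 0) ≤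
    postedPayoff μ lam (w s) (e b) + 3 * M * δ := by
  have hclose : ∀ t, |w s t - w s (τ (c t))| ≤ M * δ := fun t =>
    (hw.lip s _ _).trans (mul_le_mul_of_nonneg_left
      (hc.abs_sub_le _ _ (hτ _ (hc.lt t)).symm) hM)
  have hMδ : 0 ≤ M * δ := mul_nonneg hM hδ
  set q₁ : ℕ → ℝ := fun i => if b ≤ i then w s (τ i) - w s (τ b) else 0
  set q₂ : ℕ → ℝ := fun i => if b ≤ i then w s (τ b) else 0
  have h1 : (∑ i ∈ Finset.range n, if b ≤ i then
      (∫ t in c ⁻¹' {i}, lam t ∂μ) * (w s (τ i) - w s (τ b)) +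
      (∫ _t in c ⁻¹' {i}, (1 : ℝ) ∂μ) * w s (τ b) else 0) =
      (∫ t, lam t * q₁ (c t) ∂μ) + ∫ t, 1 * q₂ (c t) ∂μ := by
    rw [hc.integral_mul_comp hlam_int, hc.integral_mul_comp (integrable_const 1),
      ← Finset.sum_add_distrib]
    refine Finset.sum_congr rfl fun i _ => ?_
    simp only [q₁, q₂]
    split_ifs <;> simp
  have hI1 := hc.integrable_mul_comp hlam_int q₁
  have hI2 := hc.integrable_mul_comp (μ := μ) (integrable_const 1) q₂
  have hlw : Integrable (fun t => lam t * (w s t - w s (e b)) + w s (e b)) μ :=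
    (hlam_int.mul_bdd (c := 2 * B) ((hw.measurable_right s).sub_const _).aestronglyMeasurable
      (Filter.Eventually.of_forall fun t => (abs_sub _ _).trans
        (by linarith [hw.abs_le s t, hw.abs_le s (e b)]))).add (integrable_const _)
  have hI3 : Integrable (fun t => lam t * (2 * (M * δ)) + M * δ) μ :=
    (hlam_int.mul_const _).add (integrable_const _)
  rw [h1, ← integral_add hI1 hI2]
  -- Moving values and price between `τ` and the true types costs `2 * M * δ` in surplus, weighted
  -- by `lam` with mean at most one, and `M * δ` in revenue.
  calc ∫ t, (lam t * q₁ (c t) + 1 * q₂ (c t)) ∂μ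
      ≤ ∫ t, ((Set.Ici (e b)).indicator (fun t => lam t * (w s t - w s (e b)) + w s (e b)) t +
          (lam t * (2 * (M * δ)) + M * δ)) ∂μ := by
        refine integral_mono (hI1.add hI2) ((hlw.indicator measurableSet_Ici).add hI3)
          fun t => ?_
        have hl := hlam_nonneg t
        by_cases hbt : b ≤ c t
        · have hbt' : t ∈ Set.Ici (e b) := (hc.le_iff b hb t).1 hbt
          simp only [q₁, q₂, if_pos hbt, Set.indicator_of_mem hbt']
          have e1 := _root_.abs_le.1 (hclose t)
          have e2 := _root_.abs_le.1 (hclose (e b))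
          rw [hc.cell_left b hb] at e2
          have e3 : lam t * (w s (τ (c t)) - w s (τ b)) ≤
              lam t * (w s t - w s (e b) + 2 * (M * δ)) :=
            mul_le_mul_of_nonneg_left (by linarith [e1.1, e2.2]) hl
          linarith [e2.1]
        · have hbt' : t ∉ Set.Ici (e b) := fun h => hbt ((hc.le_iff b hb t).2 h)
          simp only [q₁, q₂, if_neg hbt, Set.indicator_of_notMem hbt']
          have : 0 ≤ lam t * (2 * (M * δ)) := by positivity
          linarith
    _ = postedPayoff μ lam (w s) (e b) + ((∫ t, lam t ∂μ) * (2 * (M * δ)) + M * δ) := by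
        rw [integral_add (hlw.indicator measurableSet_Ici) hI3, integral_add
          (hlam_int.mul_const _) (integrable_const _), integral_mul_const]
        simp [postedPayoff]
    _ ≤ _ := by
        have := mul_le_mul_of_nonneg_right hlam_mean (by positivity : 0 ≤ 2 * (M * δ))
        linarith

end Discretised

variable [IsFiniteMeasure G]

theorem exists_lower_le_extend [NullSingletonClass G] (hw : ItemValues w B M)
    (hr : RatioMonotone w) (x : WithOutside FunAlloc) (t : Set.Icc t₀ t₁) :
    ∃ k, allocValue G w (FunAlloc.lower k) t = extend (allocValue G w) x t ∧
      ∀ t', t ≤ t' → allocValue G w (FunAlloc.lower k) t' ≤ extend (allocValue G w) x t' := by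
  rcases x with x | _
  · exact hw.exists_lower_le hr x t
  · exact ⟨0, allocValue_lower_zero w t, fun t' _ => (allocValue_lower_zero w t').le⟩

theorem extend_le (hw : ItemValues w B M) (hB : 0 ≤ B) (x : WithOutside FunAlloc)
    (t : Set.Icc t₀ t₁) : |extend (allocValue G w) x t| ≤ B * G.real Set.univ := by
  rcases x with x | _
  · exact hw.abs_allocValue_le x t
  · change |(0 : ℝ)| ≤ _
    rw [abs_zero]; positivity

theorem abs_extend_sub_le (hw : ItemValues w B M) (hM : 0 ≤ M) (x : WithOutside FunAlloc)
    (t t' : Set.Icc t₀ t₁) :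
    |extend (allocValue G w) x t - extend (allocValue G w) x t'| ≤
      M * |(t : ℝ) - t'| * G.real Set.univ := by
  rcases x with x | _
  · exact hw.abs_allocValue_sub_le x t t'
  · change |(0 : ℝ) - 0| ≤ _
    rw [sub_zero, abs_zero]; positivity

/-- The rents in a mechanism are Lipschitz. -/
theorem abs_rent_sub_le (hw : ItemValues w B M) (hM : 0 ≤ M)
    {x : Set.Icc t₀ t₁ → WithOutside FunAlloc} {p : Set.Icc t₀ t₁ → ℝ}
    (hmech : IsMechanism (allocValue G w) x p) (t t' : Set.Icc t₀ t₁) :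
    |(extend (allocValue G w) (x t) t - p t) - (extend (allocValue G w) (x t') t' - p t')| ≤
      M * |(t : ℝ) - t'| * G.real Set.univ := by
  rw [_root_.abs_le]
  constructor
  · have h1 := hmech.ic t t'
    have h2 := neg_abs_le (extend (allocValue G w) (x t') t - extend (allocValue G w) (x t') t')
    have h3 := hw.abs_extend_sub_le (G := G) hM (x t') t t'
    linarith
  · have h1 := hmech.ic t' t
    have h2 := le_abs_self (extend (allocValue G w) (x t) t - extend (allocValue G w) (x t) t')
    have h3 := hw.abs_extend_sub_le (G := G) hM (x t) t t'
    linarith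

theorem continuous_rent (hw : ItemValues w B M) (hM : 0 ≤ M)
    {x : Set.Icc t₀ t₁ → WithOutside FunAlloc} {p : Set.Icc t₀ t₁ → ℝ}
    (hmech : IsMechanism (allocValue G w) x p) :
    Continuous fun t => extend (allocValue G w) (x t) t - p t := by
  refine (LipschitzWith.of_dist_le' (K := M * G.real Set.univ) fun t t' => ?_).continuous
  rw [Real.dist_eq, Subtype.dist_eq, Real.dist_eq]
  exact (hw.abs_rent_sub_le hM hmech t t').trans_eq (by ring)

/-- With finitely many types, monotone contracts are worth at most optimal posted prices. -/
theorem discrete_payoff_le {δ : ℝ} {n : ℕ} {c : Set.Icc t₀ t₁ → ℕ} {e : ℕ → Set.Icc t₀ t₁}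
    {μ : Measure (Set.Icc t₀ t₁)} [IsProbabilityMeasure μ] {lam : Set.Icc t₀ t₁ → ℝ}
    (hw : ItemValues w B M) (hM : 0 ≤ M)
    (ht : t₀ ≤ t₁) (hc : IsCellPartition δ n c e) (hδ : 0 ≤ δ)
    (hlam_nonneg : ∀ t, 0 ≤ lam t) (hlam_anti : Antitone lam) (hlam_mean : ∫ t, lam t ∂μ ≤ 1)
    {b : unitInterval → Set.Icc t₀ t₁} (hb : Monotone b)
    (hbmax : ∀ s b', postedPayoff μ lam (w s) b' ≤ postedPayoff μ lam (w s) (b s))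
    {τ : ℕ → Set.Icc t₀ t₁} (hτ : ∀ i < n, c (τ i) = i) {k : ℕ → unitInterval}
    (hk : ∀ i j, i ≤ j → j < n → k i ≤ k j) :
    (∑ i ∈ Finset.range n, ((∫ _t in c ⁻¹' {i}, (1 : ℝ) ∂μ) *
        allocValue G w (FunAlloc.lower (k i)) (τ i) +
      ((∫ t in c ⁻¹' {i}, lam t ∂μ) - ∫ _t in c ⁻¹' {i}, (1 : ℝ) ∂μ) *
        ∑ j ∈ Finset.range i, (allocValue G w (FunAlloc.lower (k j)) (τ (j + 1)) -
          allocValue G w (FunAlloc.lower (k j)) (τ j)))) ≤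
    (∫ s, postedPayoff μ lam (w s) (b s) ∂G) + 3 * M * δ * G.real Set.univ := by
  have hL := abs_le_of_antitone ht hlam_nonneg hlam_anti
  have hlam_int : Integrable lam μ := integrable_of_abs_le hlam_anti.measurable hL
  have hpost := hw.integrable_postedPayoff (G := G) (μ := μ) hb hlam_anti.measurable hL
  set l : ℕ → ℝ := fun i => ∫ t in c ⁻¹' {i}, lam t ∂μ
  set a : ℕ → ℝ := fun i => ∫ _t in c ⁻¹' {i}, (1 : ℝ) ∂μ
  let χ : unitInterval → ℕ → ℝ := fun s i => (FunAlloc.lower (k i) s : unitInterval)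
  have hV : ∀ i t, Integrable (fun s => χ s i * w s t) G := fun i t =>
    hw.integrable_alloc_mul _ t
  have hD : ∀ j, Integrable (fun s => χ s j * w s (τ (j + 1)) - χ s j * w s (τ j)) G := fun j =>
    (hV j _).sub (hV j _)
  have hS : ∀ i, Integrable (fun s => ∑ j ∈ Finset.range i,
      (χ s j * w s (τ (j + 1)) - χ s j * w s (τ j))) G := fun i =>
    integrable_finsetSum _ fun j _ => hD j
  have hF : ∀ i, Integrable (fun s => a i * (χ s i * w s (τ i)) + (l i - a i) *
      ∑ j ∈ Finset.range i, (χ s j * w s (τ (j + 1)) - χ s j * w s (τ j))) G := fun i =>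
    ((hV i _).const_mul _).add ((hS i).const_mul _)
  have h1 : (∑ i ∈ Finset.range n, (a i * allocValue G w (FunAlloc.lower (k i)) (τ i) +
      (l i - a i) * ∑ j ∈ Finset.range i, (allocValue G w (FunAlloc.lower (k j)) (τ (j + 1)) -
          allocValue G w (FunAlloc.lower (k j)) (τ j)))) =
      ∫ s, ∑ i ∈ Finset.range n, (a i * (χ s i * w s (τ i)) + (l i - a i) *
        ∑ j ∈ Finset.range i, (χ s j * w s (τ (j + 1)) - χ s j * w s (τ j))) ∂G := by
    rw [integral_finsetSum _ fun i _ => hF i]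
    refine Finset.sum_congr rfl fun i _ => ?_
    rw [integral_add ((hV i _).const_mul _) ((hS i).const_mul _), integral_const_mul,
      integral_const_mul, integral_finsetSum _ fun j _ => hD j]
    congr 2
    refine Finset.sum_congr rfl fun j _ => ?_
    rw [integral_sub (hV j _) (hV j _)]
    rfl
  rw [h1]
  calc _ ≤ ∫ s, (postedPayoff μ lam (w s) (b s) + 3 * M * δ) ∂G := by
        refine integral_mono (integrable_finsetSum _ fun i _ => hF i)
          (hpost.add (integrable_const _)) fun s => ?_
        have hχ : ∀ i, χ s i = if s ≤ k i then 1 else 0 := fun i => by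
          have := FunAlloc.lower_mul (k i) s 1
          rwa [mul_one] at this
        simp only
        -- The cutoff of item `s` is the first index at which it is sold. A never-sold item has
        -- cutoff `n` and payoff zero, which the optimum exceeds because selling at cutoff `t₁` is
        -- already worth a nonnegative amount.
        by_cases hex : ∃ i, i < n ∧ s ≤ k i
        · classical
          obtain ⟨hn, hs⟩ := Nat.find_spec hex
          rw [item_payoff_eq (b := Nat.find hex)]
          · refine (hw.discrete_postedPayoff_le hM hc hδ hlam_nonneg hlam_int hlam_mean hτ s
              hn).trans ?_
            linarith [hbmax s (e (Nat.find hex))]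
          · intro i hi
            rw [hχ, if_neg fun h => Nat.find_min hex hi ⟨hi.trans hn, h⟩]
          · intro i hi hin
            rw [hχ, if_pos (hs.trans (hk _ _ hi hin))]
        · rw [item_payoff_eq (b := n) (fun i hi => ?_) (fun i h1 h2 => absurd h1 (not_le.2 h2))]
          · rw [Finset.sum_eq_zero fun i hi => if_neg (not_le.2 (Finset.mem_range.1 hi))]
            have h0 : 0 ≤ postedPayoff μ lam (w s) ⟨t₁, Set.right_mem_Icc.2 ht⟩ := by
              refine integral_nonneg fun t => Set.indicator_nonneg (fun t htt => ?_) t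
              have : t = ⟨t₁, Set.right_mem_Icc.2 ht⟩ := le_antisymm (Subtype.coe_le_coe.1 t.2.2) htt
              rw [this, sub_self, mul_zero, zero_add]
              exact (hw.pos _ _).le
            have := hbmax s ⟨t₁, Set.right_mem_Icc.2 ht⟩
            have : 0 ≤ 3 * M * δ := by positivity
            linarith
          · rw [hχ, if_neg fun h => hex ⟨i, hi, h⟩]
    _ = _ := by
        rw [integral_add hpost (integrable_const _), integral_const, smul_eq_mul]
        ring

/-- No mechanism is better for the principal than optimal posted prices. -/
theorem payoff_le_posted [NullSingletonClass G] (hw : ItemValues w B M) (hr : RatioMonotone w)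
    (hM : 0 ≤ M) (ht : t₀ < t₁) {μ : Measure (Set.Icc t₀ t₁)} [IsProbabilityMeasure μ]
    [NullSingletonClass μ] {lam : Set.Icc t₀ t₁ → ℝ}
    (hlam_nonneg : ∀ t, 0 ≤ lam t) (hlam_anti : Antitone lam) (hlam_mean : ∫ t, lam t ∂μ ≤ 1)
    {b : unitInterval → Set.Icc t₀ t₁} (hb : Monotone b)
    (hbmax : ∀ s b', postedPayoff μ lam (w s) b' ≤ postedPayoff μ lam (w s) (b s))
    {x : Set.Icc t₀ t₁ → WithOutside FunAlloc} {p : Set.Icc t₀ t₁ → ℝ}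
    (hmech : IsMechanism (allocValue G w) x p) :
    (∫ t, lam t * (extend (allocValue G w) (x t) t - p t) ∂μ) + ∫ t, p t ∂μ ≤
      ∫ s, postedPayoff μ lam (w s) (b s) ∂G := by
  have hB : 0 ≤ B := (abs_nonneg _).trans (hw.abs_le 0 ⟨t₀, Set.left_mem_Icc.2 ht.le⟩)
  have hL := abs_le_of_antitone ht.le hlam_nonneg hlam_anti
  have hlam_int : Integrable lam μ := integrable_of_abs_le hlam_anti.measurable hL
  set g := G.real Set.univ
  have hg0 : 0 ≤ g := measureReal_nonneg
  set U : Set.Icc t₀ t₁ → ℝ := fun t => extend (allocValue G w) (x t) t - p t with hU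
  have hUc : Continuous U := hw.continuous_rent hM hmech
  obtain ⟨C, hC⟩ : ∃ C, ∀ t, |U t| ≤ C := by
    obtain ⟨C, hC⟩ := isCompact_univ.exists_bound_of_continuousOn hUc.continuousOn
    exact ⟨C, fun t => hC t (Set.mem_univ t)⟩
  have hp_le : ∀ t, p t ≤ B * g := fun t => by
    have h1 := hmech.ir t
    have h2 := (le_abs_self _).trans (hw.extend_le (G := G) hB (x t) t)
    linarith
  have hp_abs : ∀ t, |p t| ≤ B * g + C := fun t => by
    have h2 := _root_.abs_le.1 (hw.extend_le (G := G) hB (x t) t)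
    have h3 := _root_.abs_le.1 (hC t)
    rw [hU] at h3
    rw [_root_.abs_le]
    constructor <;> linarith [h2.1, h2.2, h3.1, h3.2]
  have hp_int : Integrable p μ :=
    integrable_of_abs_le (measurable_snd.comp hmech.measurable) hp_abs
  have hlU : Integrable (fun t => lam t * U t) μ :=
    hlam_int.mul_bdd hUc.measurable.aestronglyMeasurable (Filter.Eventually.of_forall hC)
  -- The error consists of `3 * M * g * δ` from discrete posted prices, `M * g * δ` from sampling
  -- rents and `δ` from sampling payments.
  suffices H : ∀ δ > 0, (∫ t, lam t * U t ∂μ) + ∫ t, p t ∂μ ≤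
      (∫ s, postedPayoff μ lam (w s) (b s) ∂G) + (4 * M * g + 1) * δ by
    refine le_of_forall_pos_le_add fun ε hε => ?_
    have hpos : 0 < 4 * M * g + 1 := by positivity
    have := H (ε / (4 * M * g + 1)) (by positivity)
    rwa [mul_div_cancel₀ _ hpos.ne'] at this
  intro δ hδ
  obtain ⟨n, c, e, hc⟩ := exists_isCellPartition ht hδ
  have hn : 0 < n := (Nat.zero_le _).trans_lt (hc.lt ⟨t₀, Set.left_mem_Icc.2 ht.le⟩)
  -- Rents are Lipschitz, so any representative serves for them; payments may jump within a cell, so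
  -- it is chosen to nearly maximize the payment.
  obtain ⟨τ, hτm, hτ, hτp⟩ := hc.exists_representatives hp_le hδ hn
  set l : ℕ → ℝ := fun i => ∫ t in c ⁻¹' {i}, lam t ∂μ
  set a : ℕ → ℝ := fun i => ∫ _t in c ⁻¹' {i}, (1 : ℝ) ∂μ
  have hl0 : ∀ i, 0 ≤ l i := fun i => integral_nonneg fun t => hlam_nonneg t
  have ha0 : ∀ i, 0 ≤ a i := fun i => integral_nonneg fun t => zero_le_one
  have hla : ∀ i j, i ≤ j → l j * a i ≤ l i * a j := fun i j hij =>
    hc.ratio_antitone hlam_anti hlam_int hij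
  have hl1 : ∑ i ∈ Finset.range n, l i ≤ 1 := by
    have := hc.integral_mul_comp hlam_int fun _ => 1
    simp only [mul_one] at this
    rw [← this]
    exact hlam_mean
  have ha1 : ∑ i ∈ Finset.range n, a i = 1 := by
    have := hc.integral_mul_comp (μ := μ) (integrable_const 1) fun _ => 1
    simp only [mul_one] at this
    rw [← this]
    simp
  -- replace the contracts of the representatives by lower sets
  choose k hk hk' using fun i => hw.exists_lower_le_extend (G := G) hr (x (τ i)) (τ i)
  let V : unitInterval → ℕ → ℝ := fun k i => allocValue G w (FunAlloc.lower k) (τ i)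
  have hsub : ∀ k k' i, k ≤ k' → V k' i - V k i = ∫ s in Set.Ioc k k', w s (τ i) ∂G :=
    fun k k' i hkk => hw.allocValue_lower_sub hkk (τ i)
  have hVk : ∀ i, Monotone fun k => V k i := fun i k k' hkk => by
    rw [← sub_nonneg]
    simp only [hsub k k' i hkk]
    exact integral_nonneg fun s => (hw.pos s _).le
  have hVi : ∀ k, Monotone (V k) := fun k i j hij =>
    integral_mono (hw.integrable_alloc_mul _ _) (hw.integrable_alloc_mul _ _) fun s =>
      mul_le_mul_of_nonneg_left (hw.mono s (hτm hij)) (FunAlloc.coe_nonneg _ s)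
  have hVd : ∀ k k', k ≤ k' → Monotone fun i => V k' i - V k i := fun k k' hkk i j hij => by
    simp only [hsub k k' _ hkk]
    exact integral_mono (hw.integrable G _).integrableOn (hw.integrable G _).integrableOn
      fun s => hw.mono s (hτm hij)
  have hVU : ∀ i, V (k i) i - p (τ i) = U (τ i) := fun i => by
    simp only [V, hk, hU]
  -- The replacement keeps truthful values and lowers what higher types get from imitating, so
  -- exactly the downward constraints are inherited.
  have hic : DownwardIC V n k fun i => p (τ i) := fun i j hij _ => by
    rw [hVU j]
    exact (sub_le_sub_right (hk' i (τ j) (hτm hij)) _).trans (hmech.ic (τ j) (τ i))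
  have hir : IndivRational V n k fun i => p (τ i) := fun j _ => by
    rw [hVU j]
    exact hmech.ir (τ j)
  obtain ⟨k₁, p₁, hic₁, hir₁, hk₁, hpay⟩ :=
    exists_monotone_payoff_le hVk hVi hVd hl0 ha0 hla k (fun i => p (τ i)) hic hir
  have hbound := (payoff_le_of_downwardIC ha0 hla ha1 hl1 hic₁ hir₁).trans
    (hw.discrete_payoff_le (G := G) hM ht.le hc hδ.le hlam_nonneg hlam_anti hlam_mean hb hbmax
      hτ hk₁)
  have hdisc : (∫ t, lam t * U (τ (c t)) ∂μ) + ∫ t, 1 * p (τ (c t)) ∂μ =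
      payoff V l a n k fun i => p (τ i) := by
    rw [hc.integral_mul_comp hlam_int fun i => U (τ i),
      hc.integral_mul_comp (integrable_const 1) fun i => p (τ i), ← Finset.sum_add_distrib, payoff]
    exact Finset.sum_congr rfl fun i _ => by rw [hVU]
  have hI1 := hc.integrable_mul_comp hlam_int fun i => U (τ i)
  have hI2 := hc.integrable_mul_comp (μ := μ) (integrable_const 1) fun i => p (τ i)
  have h1 : ∫ t, lam t * U t ∂μ ≤ (∫ t, lam t * U (τ (c t)) ∂μ) + M * g * δ := by
    have hMg : 0 ≤ M * g * δ := by positivity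
    calc ∫ t, lam t * U t ∂μ ≤ ∫ t, (lam t * U (τ (c t)) + lam t * (M * g * δ)) ∂μ := by
          refine integral_mono hlU (hI1.add (hlam_int.mul_const _)) fun t => ?_
          have e1 := (le_abs_self _).trans (hw.abs_rent_sub_le hM hmech t (τ (c t)))
          have e2 : M * |(t : ℝ) - τ (c t)| * g ≤ M * δ * g := by
            gcongr
            exact hc.abs_sub_le _ _ (hτ _ (hc.lt t)).symm
          simp only
          rw [← mul_add]
          refine mul_le_mul_of_nonneg_left ?_ (hlam_nonneg t)
          simp only [hU]
          linarith
      _ = (∫ t, lam t * U (τ (c t)) ∂μ) + (∫ t, lam t ∂μ) * (M * g * δ) := by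
          rw [integral_add hI1 (hlam_int.mul_const _), integral_mul_const]
      _ ≤ _ := by
          have := mul_le_mul_of_nonneg_right hlam_mean hMg
          linarith
  have h2 : ∫ t, p t ∂μ ≤ (∫ t, 1 * p (τ (c t)) ∂μ) + δ := by
    calc ∫ t, p t ∂μ ≤ ∫ t, (1 * p (τ (c t)) + δ) ∂μ := by
          refine integral_mono hp_int (hI2.add (integrable_const _)) fun t => ?_
          simp only [one_mul]
          exact hτp t
      _ = _ := by
          rw [integral_add hI2 (integrable_const _)]
          simp
  linarith

end ItemValues

/-! ### The law of the type -/

section Law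

variable {t₀ t₁ : ℝ}

/-- The law of a type with density `f`. -/
def typeLaw (f : Set.Icc t₀ t₁ → ℝ) : Measure (Set.Icc t₀ t₁) :=
  (typeVolume t₀ t₁).withDensity fun t => ENNReal.ofReal (f t)

theorem expect_eq_integral {f : Set.Icc t₀ t₁ → ℝ} (hf : Measurable f) (hf0 : ∀ t, 0 ≤ f t)
    (h : Set.Icc t₀ t₁ → ℝ) : expect f h = ∫ t, h t ∂typeLaw f := by
  rw [typeLaw, integral_withDensity_eq_integral_toReal_smul hf.ennreal_ofReal
    (Filter.Eventually.of_forall fun _ => ENNReal.ofReal_lt_top), expect]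
  refine integral_congr_ae (Filter.Eventually.of_forall fun t => ?_)
  simp only [ENNReal.toReal_ofReal (hf0 t), smul_eq_mul, mul_comm]

theorem isProbabilityMeasure_typeLaw {f : Set.Icc t₀ t₁ → ℝ} (hf0 : ∀ t, 0 ≤ f t)
    (hf1 : ∫ t, f t ∂typeVolume t₀ t₁ = 1) : IsProbabilityMeasure (typeLaw f) := by
  constructor
  have hint : Integrable f (typeVolume t₀ t₁) := by
    by_contra h
    rw [integral_undef h] at hf1
    exact zero_ne_one hf1
  rw [typeLaw, withDensity_apply _ MeasurableSet.univ, Measure.restrict_univ,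
    ← ofReal_integral_eq_lintegral_ofReal hint (Filter.Eventually.of_forall hf0), hf1,
    ENNReal.ofReal_one]

theorem nullSingletonClass_typeLaw (f : Set.Icc t₀ t₁ → ℝ) : NullSingletonClass (typeLaw f) := by
  constructor
  intro t
  refine withDensity_absolutelyContinuous _ _ ?_
  rw [typeVolume, (MeasurableEmbedding.subtype_coe measurableSet_Icc).comap_apply]
  simp

end Law

/-! ### Change of the allocation space -/

section Transfer

variable {X X' : Type*}

theorem extend_map {T : Type*} {v : X → T → ℝ} {v' : X' → T → ℝ} {φ : X → X'}
    (hv : ∀ x t, v' (φ x) t = v x t) (y : WithOutside X) (t : T) :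
    extend v' (Sum.map φ id y) t = extend v y t := by
  rcases y with x | _
  · exact hv x t
  · rfl

theorem objective_map {t₀ t₁ : ℝ} {v : X → Set.Icc t₀ t₁ → ℝ} {v' : X' → Set.Icc t₀ t₁ → ℝ}
    {φ : X → X'} (hv : ∀ x t, v' (φ x) t = v x t) (f lam : Set.Icc t₀ t₁ → ℝ)
    (x : Set.Icc t₀ t₁ → WithOutside X) (p : Set.Icc t₀ t₁ → ℝ) :
    objective v' f lam (fun t => Sum.map φ id (x t)) p = objective v f lam x p := by
  simp only [objective, extend_map hv]

variable [MeasurableSpace X] [MeasurableSpace X']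

theorem IsMechanism.map {T : Type*} [MeasurableSpace T] {v : X → T → ℝ} {v' : X' → T → ℝ}
    {φ : X → X'} (hφ : Measurable φ) (hv : ∀ x t, v' (φ x) t = v x t) {x : T → WithOutside X}
    {p : T → ℝ} (h : IsMechanism v x p) :
    IsMechanism v' (fun t => Sum.map φ id (x t)) p where
  measurable := ((hφ.sumMap measurable_id).comp (measurable_fst.comp h.measurable)).prodMk
    (measurable_snd.comp h.measurable)
  ic t t' := by
    rw [extend_map hv, extend_map hv]
    exact h.ic t t'
  ir t := by
    rw [extend_map hv]
    exact h.ir t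

/-- A value-preserving measurable equivalence matches mechanisms in both directions with equal
objectives; the inverse direction carries competitors back. -/
theorem IsOptimalMenu.map {t₀ t₁ : ℝ} {v : X → Set.Icc t₀ t₁ → ℝ} {v' : X' → Set.Icc t₀ t₁ → ℝ}
    {f lam : Set.Icc t₀ t₁ → ℝ} {Y : Set X} (φ : X ≃ᵐ X') (hv : ∀ x t, v' (φ x) t = v x t)
    (h : IsOptimalMenu v f lam Y) : IsOptimalMenu v' f lam (φ '' Y) := by
  obtain ⟨x, p, ⟨hmech, hopt⟩, hY⟩ := h
  have hv' : ∀ x t, v (φ.symm x) t = v' x t := fun x t => by rw [← hv, φ.apply_symm_apply]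
  refine ⟨fun t => Sum.map φ id (x t), p, ⟨hmech.map φ.measurable hv, fun x' p' h' => ?_⟩,
    fun t => ?_⟩
  · rw [objective_map hv, ← objective_map hv']
    exact hopt _ _ (h'.map φ.symm.measurable hv')
  · rcases hY t with h | ⟨y, hy, h⟩
    · exact Or.inl (by simp [h])
    · exact Or.inr ⟨φ y, ⟨y, hy, rfl⟩, by simp [← h]⟩

end Transfer

/-! ### Reflection of the unit interval -/

namespace FunAlloc

/-- The reflected allocation `s ↦ x (1 - s)`. -/
def reflect (x : FunAlloc) : FunAlloc :=
  ⟨fun s => x (unitInterval.symm s), x.2.comp unitInterval.measurable_symm⟩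

theorem reflect_reflect (x : FunAlloc) : x.reflect.reflect = x :=
  Subtype.ext (funext fun s => congrArg x.1 (unitInterval.symm_symm s))

/-- Lebesgue measure is invariant under reflection. The isometry supplies Borel measurability of
`reflectEquiv`. -/
theorem isometry_reflect : Isometry reflect := by
  refine Isometry.of_dist_eq fun x y => ?_
  exact unitInterval.measurePreserving_symm.integral_comp
    unitInterval.symmMeasurableEquiv.measurableEmbedding fun s => |(x s : ℝ) - y s|

/-- Reflection as a measurable equivalence. -/
def reflectEquiv : FunAlloc ≃ᵐ FunAlloc where
  toFun := reflect
  invFun := reflect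
  left_inv := reflect_reflect
  right_inv := reflect_reflect
  measurable_toFun := isometry_reflect.continuous.measurable
  measurable_invFun := isometry_reflect.continuous.measurable

theorem reflect_lower (k : unitInterval) : reflect (lower k) = upper (unitInterval.symm k) := by
  refine Subtype.ext (funext fun s => ?_)
  change (Set.Icc 0 k).indicator 1 (unitInterval.symm s) =
    (Set.Icc (unitInterval.symm k) 1).indicator 1 s
  have h : unitInterval.symm s ∈ Set.Icc 0 k ↔ s ∈ Set.Icc (unitInterval.symm k) 1 := by
    simp only [Set.mem_Icc, unitInterval.nonneg', unitInterval.le_one', true_and, and_true]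
    rw [← unitInterval.symm_le_symm, unitInterval.symm_symm]
  by_cases hs : s ∈ Set.Icc (unitInterval.symm k) 1
  · rw [Set.indicator_of_mem hs, Set.indicator_of_mem (h.2 hs)]
    rfl
  · rw [Set.indicator_of_notMem hs, Set.indicator_of_notMem (mt h.1 hs)]

theorem image_reflect_range_lower : reflectEquiv '' Set.range lower = Set.range upper := by
  rw [← Set.range_comp]
  have h : reflectEquiv ∘ lower = upper ∘ unitInterval.symm := funext reflect_lower
  rw [h]
  exact unitInterval.symm_bijective.surjective.range_comp _

end FunAlloc

theorem allocValue_reflect {t₀ t₁ : ℝ} (G : Measure unitInterval)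
    (w : unitInterval → Set.Icc t₀ t₁ → ℝ) (x : FunAlloc) (t : Set.Icc t₀ t₁) :
    allocValue G w (FunAlloc.reflectEquiv x) t =
      allocValue (G.map unitInterval.symm) (fun s => w (unitInterval.symm s)) x t := by
  refine Eq.trans ?_ (integral_map_equiv unitInterval.symmMeasurableEquiv _).symm
  refine integral_congr_ae (Filter.Eventually.of_forall fun s => ?_)
  change ((x (unitInterval.symm s) : unitInterval) : ℝ) * w s t =
    (x (unitInterval.symm s) : ℝ) * w (unitInterval.symm (unitInterval.symm s)) t
  rw [unitInterval.symm_symm]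

theorem ItemValues.reflect {t₀ t₁ B M : ℝ} {w : unitInterval → Set.Icc t₀ t₁ → ℝ}
    (hw : ItemValues w B M) : ItemValues (fun s => w (unitInterval.symm s)) B M where
  meas := hw.meas.comp ((unitInterval.measurable_symm.comp measurable_fst).prodMk measurable_snd)
  pos _ := hw.pos _
  le _ := hw.le _
  lip _ := hw.lip _
  mono _ := hw.mono _

/-! ### Optimality of lower sets -/

/-- The posted-price mechanism with increasing optimal cutoffs attains the upper bound
`payoff_le_posted`. -/
theorem isOptimalMenu_lower {t₀ t₁ : ℝ} (ht : t₀ < t₁) {f lam : Set.Icc t₀ t₁ → ℝ}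
    (hf : Measurable f) (hf0 : ∀ t, 0 ≤ f t) (hf1 : ∫ t, f t ∂typeVolume t₀ t₁ = 1)
    (hlam_nonneg : ∀ t, 0 ≤ lam t) (hlam_anti : Antitone lam) (hlam_mean : expect f lam ≤ 1)
    {G : Measure unitInterval} [IsFiniteMeasure G] [NullSingletonClass G] {B M : ℝ} (hM : 0 ≤ M)
    {w : unitInterval → Set.Icc t₀ t₁ → ℝ} (hw : ItemValues w B M) (hr : RatioMonotone w) :
    IsOptimalMenu (allocValue G w) f lam (Set.range FunAlloc.lower) := by
  have := isProbabilityMeasure_typeLaw hf0 hf1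
  have := nullSingletonClass_typeLaw f
  rw [expect_eq_integral hf hf0] at hlam_mean
  obtain ⟨b, hb, hbmax⟩ := hw.exists_monotone_cutoff hr ht.le hlam_nonneg hlam_anti hlam_mean
  refine ⟨postedAlloc b, postedPrice G w b, ⟨hw.isMechanism_posted hb, fun x p hmech => ?_⟩,
    fun t => Or.inr ⟨_, ⟨cutoffItem b t, rfl⟩, rfl⟩⟩
  simp only [objective, expect_eq_integral hf hf0]
  rw [hw.payoff_posted hb hlam_anti.measurable (abs_le_of_antitone ht.le hlam_nonneg hlam_anti)]
  exact hw.payoff_le_posted hr hM ht hlam_nonneg hlam_anti hlam_mean hb hbmax hmech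

/-- The mean value inequality turns the derivative bound into a Lipschitz constant; the maximum with
`0` makes its sign immediate. -/
theorem itemValues_of_contDiffOn {t₀ t₁ B M : ℝ} {u : unitInterval → ℝ → ℝ}
    (hu_meas : Measurable fun z : unitInterval × Set.Icc t₀ t₁ => u z.1 z.2)
    (hu_pos : ∀ s, ∀ t ∈ Set.Icc t₀ t₁, 0 < u s t) (hB : ∀ s, ∀ t ∈ Set.Icc t₀ t₁, u s t ≤ B)
    (hu_diff : ∀ s, ContDiffOn ℝ 1 (u s) (Set.Icc t₀ t₁))
    (hM : ∀ s, ∀ t ∈ Set.Icc t₀ t₁, |derivWithin (u s) (Set.Icc t₀ t₁) t| ≤ M)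
    (hu_mono : ∀ s, StrictMonoOn (u s) (Set.Icc t₀ t₁)) :
    ItemValues (fun s (t : Set.Icc t₀ t₁) => u s t) B (max M 0) where
  meas := hu_meas
  pos s t := hu_pos s t t.2
  le s t := hB s t t.2
  lip s t t' := Convex.norm_image_sub_le_of_norm_derivWithin_le (𝕜 := ℝ)
    ((hu_diff s).differentiableOn one_ne_zero) (fun r hr => (hM s r hr).trans (le_max_left M 0))
    (convex_Icc t₀ t₁) t'.2 t.2
  mono s t t' htt := (hu_mono s).monotoneOn t.2 t'.2 htt

end Screening

end

/-! ### The two cases of the proposition -/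

theorem mainTheorem12
    -- the type space, the type density and the welfare weights
    (t₀ t₁ : ℝ) (ht : t₀ < t₁)
    (f : Set.Icc t₀ t₁ → ℝ) (hf_cont : Continuous f) (hf_pos : ∀ t, 0 < f t)
    (hf_int : ∫ t, f t ∂Screening.typeVolume t₀ t₁ = 1)
    (lam : Set.Icc t₀ t₁ → ℝ) (hlam_cont : Continuous lam) (hlam_nonneg : ∀ t, 0 ≤ lam t)
    (hlam_anti : Antitone lam) (hlam_mean : Screening.expect f lam ≤ 1)
    -- the measure on `[0,1]`
    (G : Measure unitInterval) [IsFiniteMeasure G] (hG_ac : G ≪ volume)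
    (hG_supp : G.IsOpenPosMeasure)
    -- the function `u`
    (u : unitInterval → ℝ → ℝ)
    (hu_meas : Measurable fun z : unitInterval × Set.Icc t₀ t₁ => u z.1 z.2)
    (hu_pos : ∀ s, ∀ t ∈ Set.Icc t₀ t₁, 0 < u s t)
    (hu_bdd : ∃ B : ℝ, ∀ s, ∀ t ∈ Set.Icc t₀ t₁, u s t ≤ B)
    (hu_diff : ∀ s, ContDiffOn ℝ 1 (u s) (Set.Icc t₀ t₁))
    (hu_deriv_bdd : ∃ M : ℝ, ∀ s, ∀ t ∈ Set.Icc t₀ t₁,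
      |derivWithin (u s) (Set.Icc t₀ t₁) t| ≤ M)
    (hu_mono : ∀ s, StrictMonoOn (u s) (Set.Icc t₀ t₁)) :
    (Screening.LogSupermodularOn u (Set.Icc t₀ t₁) →
      Screening.IsOptimalMenu (Screening.FunAlloc.value G u) f lam
        (Set.range Screening.FunAlloc.lower)) ∧
    (Screening.LogSubmodularOn u (Set.Icc t₀ t₁) →
      Screening.IsOptimalMenu (Screening.FunAlloc.value G u) f lam
        (Set.range Screening.FunAlloc.upper)) := by
  obtain ⟨B, hB⟩ := hu_bdd
  obtain ⟨M, hM⟩ := hu_deriv_bdd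
  have hw := Screening.itemValues_of_contDiffOn hu_meas hu_pos hB hu_diff hM hu_mono
  have hf0 : ∀ t, 0 ≤ f t := fun t => (hf_pos t).le
  -- Absolute continuity is used only through the absence of atoms.
  have hG : NullSingletonClass G := ⟨fun s => hG_ac (measure_singleton s)⟩
  constructor
  · intro hlog
    refine Screening.isOptimalMenu_lower ht hf_cont.measurable hf0 hf_int hlam_nonneg hlam_anti
      hlam_mean (le_max_right M 0) hw fun s s' hs t t' htt => ?_
    have h := hlog s s' hs t t.2 t' t'.2 htt
    have p := fun s (t : Set.Icc t₀ t₁) => hu_pos s t t.2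
    rwa [← Real.log_mul (p s t').ne' (p s' t).ne', ← Real.log_mul (p s t).ne' (p s' t').ne',
      Real.log_le_log_iff (mul_pos (p s t') (p s' t)) (mul_pos (p s t) (p s' t'))] at h
  · intro hlog
    have hG' : NullSingletonClass (G.map unitInterval.symm) := ⟨fun s => by
      rw [Measure.map_apply unitInterval.measurable_symm (measurableSet_singleton s)]
      exact (Set.subsingleton_singleton.preimage
        unitInterval.symm_bijective.injective).measure_zero G⟩
    -- Reflection reverses the order of the items, so log-submodularity of `u` becomes
    -- `RatioMonotone` for the reflected values under the reflected measure; upper sets are the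
    -- reflected lower sets.
    have h := Screening.isOptimalMenu_lower (G := G.map unitInterval.symm) ht hf_cont.measurable
      hf0 hf_int hlam_nonneg hlam_anti hlam_mean (le_max_right M 0) hw.reflect
      fun s s' hs t t' htt => by
        have h := hlog _ _ (unitInterval.symm_le_symm.2 hs) t t.2 t' t'.2 htt
        have p := fun s (t : Set.Icc t₀ t₁) => hu_pos s t t.2
        rw [← Real.log_mul (p _ t).ne' (p _ t').ne', ← Real.log_mul (p _ t').ne' (p _ t).ne',
          Real.log_le_log_iff (mul_pos (p _ t) (p _ t')) (mul_pos (p _ t') (p _ t))] at h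
        linarith
    rw [← Screening.FunAlloc.image_reflect_range_lower]
    exact h.map Screening.FunAlloc.reflectEquiv fun x t =>
      Screening.allocValue_reflect G (fun s (t : Set.Icc t₀ t₁) => u s t) x t
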